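/- Let $G$ be a Carnot group, that is, a simply connected Lie group whose Lie algebra $\mathfrak g$ is equipped with a stratification $\mathfrak g=V_1\oplus\dots\oplus V_s$, $[V_1,V_j]=V_{j+1}$ for $1\le j\le s$ with $V_{s+1}=\{0\}$ and $V_s\neq\{0\}$ (with $s=0$ if $\mathfrak g=\{0\}$). Let $m=\dim G$ and $n=\dim V_1$, and identify $G$ with $\mathbb R^m$ by a diffeomorphism. Let $X_1,\dots,X_n$ be the vector fields on $\mathbb R^m$ that correspond to the left-invariant vector fields on $G$ given by a basis of $V_1$. For a vector field $X\in\{X_1,\dots,X_n\}$, $p\in\mathbb R^m$ and $S\subseteq\mathbb R^m$, put $|S\cap(p\cdot\mathbb RX)|=\mathcal L^1(\{t\in\mathbb R:\gamma(t)\in S\})$, where $\gamma:\mathbb R\to\mathbb R^m$ is the integral curve of $X$ with $\gamma(0)=p$. For $A\subseteq\mathbb R^m$ and $i\in\{1,\dots,n\}$, put $$A_i=\{p\in A:\ |A\cap(p\cdot\mathbb RX_i)|>0\},$$ and for words in the alphabet $\{1,\dots,n\}$ put $A_\emptyset=A$ and $A_{w'i}=(A_{w'})_i$. Let $w=12\cdots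 n$ and let $w^k$ be its $k$-fold concatenation. Let $A\subset\mathbb R^m$ be a Borel set of Lebesgue measure $0$. Then $A=C_1\cup\dots\cup C_n$, where the sets $$C_i=\bigcup_{k=0}^{m-1}\bigl(A_{w^k1\cdots(i-1)}\setminus A_{w^k1\cdots i}\bigr),\qquad i=1,\dots,n,$$ are Borel and pairwise disjoint, and for each $i\in\{1,\dots,n\}$ $$|C_i\cap(x\cdot\mathbb RX_i)|=0\qquad\text{for all }x\in\mathbb R^m.$$ -/

import Mathlib

open MeasureTheory
open scoped Manifold ContDiff ENNReal

/-- A smooth real Lie group is in particular regular enough to have a Lie algebra. -/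
instance LieGroup.minSmoothness_of_smooth {E H G : Type*} [NormedAddCommGroup E] [NormedSpace ℝ E]
    [TopologicalSpace H] {I : ModelWithCorners ℝ E H} [TopologicalSpace G] [ChartedSpace H G]
    [Group G] [LieGroup I ∞ G] : LieGroup I (minSmoothness ℝ 3) G := by
  rw [minSmoothness_of_isRCLikeNormedField]
  infer_instance

/-- A stratification `L = V₁ ⊕ ⋯ ⊕ V_s` of a real Lie algebra: `[V₁, V_j] = V_{j+1}` for
`1 ≤ j ≤ s`, where `V_{s+1} = 0`, and `V_s ≠ 0` (the zero algebra being stratified with `s = 0`).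
Layers with an index outside `{1, …, s}` are zero. -/
structure LieStratification (L : Type*) [LieRing L] [LieAlgebra ℝ L] where
  /-- the number `s` of layers -/
  step : ℕ
  /-- the layers `V_j` -/
  layer : ℕ → Submodule ℝ L
  layer_eq_bot : ∀ j, j = 0 ∨ step < j → layer j = ⊥
  layer_step_ne_bot : step ≠ 0 → layer step ≠ ⊥
  isInternal : DirectSum.IsInternal layer
  span_bracket : ∀ j, 1 ≤ j → j ≤ step →
    Submodule.span ℝ {z : L | ∃ x ∈ layer 1, ∃ y ∈ layer j, ⁅x, y⁆ = z} = layer (j + 1)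

namespace NullDecomposition

/-- For a Lie group `G` identified with `ℝ^m` by the diffeomorphism `φ`, the vector field on `ℝ^m`
that corresponds to the left-invariant vector field on `G` with value `v` at the identity. -/
noncomputable def coordField {m : ℕ} {G : Type*} [TopologicalSpace G]
    [ChartedSpace (EuclideanSpace ℝ (Fin m)) G] [Group G] [LieGroup (𝓡 m) ∞ G]
    (φ : G ≃ₘ⟮𝓡 m, 𝓡 m⟯ EuclideanSpace ℝ (Fin m)) (v : GroupLieAlgebra (𝓡 m) G)
    (x : EuclideanSpace ℝ (Fin m)) : EuclideanSpace ℝ (Fin m) :=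
  mfderiv (𝓡 m) (𝓡 m) φ (φ.symm x) (mulInvariantVectorField v (φ.symm x))

/-- `|S ∩ (p · ℝX)|`: the one-dimensional Lebesgue measure of the set of times that the flow line of
the vector field `X` through `p` spends in `S`. A left-invariant vector field on a Lie group has
exactly one integral curve `γ : ℝ → E` with `γ 0 = p`; the supremum is its value at this `γ`. -/
noncomputable def lineMeasure {E : Type*} [NormedAddCommGroup E] [NormedSpace ℝ E]
    (X : E → E) (S : Set E) (p : E) : ℝ≥0∞ :=
  ⨆ γ : {γ : ℝ → E // IsIntegralCurve γ (fun _ => X) ∧ γ 0 = p}, volume (γ.1 ⁻¹' S)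

/-- `A_i = {p ∈ A : |A ∩ (p · ℝX_i)| > 0}`, for a single vector field `X = X_i`. -/
def positivePart {E : Type*} [NormedAddCommGroup E] [NormedSpace ℝ E]
    (X : E → E) (A : Set E) : Set E :=
  {p ∈ A | 0 < lineMeasure X A p}

/-- `A_w` for a word `w` in the letters `Fin n`: `A_∅ = A` and `A_{w'i} = (A_{w'})_i`. -/
def wordPart {E : Type*} [NormedAddCommGroup E] [NormedSpace ℝ E] {n : ℕ}
    (X : Fin n → E → E) (A : Set E) (w : List (Fin n)) : Set E :=
  w.foldl (fun B i => positivePart (X i) B) A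

/-- The word `w^k`, the `k`-fold concatenation of the word `w = 12⋯n` of all letters. -/
def fullWord (n k : ℕ) : List (Fin n) :=
  (List.replicate k (List.finRange n)).flatten

/-- `C_i = ⋃_{k=0}^{m-1} (A_{w^k 1⋯(i-1)} \ A_{w^k 1⋯i})`. As the letters of `Fin n` are counted
from zero, `1⋯(i-1)` is the list of the first `i` letters and `1⋯i` that of the first `i + 1`. -/
def piece {E : Type*} [NormedAddCommGroup E] [NormedSpace ℝ E] {n : ℕ}
    (m : ℕ) (X : Fin n → E → E) (A : Set E) (i : Fin n) : Set E :=
  ⋃ k ∈ Finset.range m,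
    wordPart X A (fullWord n k ++ (List.finRange n).take (i : ℕ)) \
      wordPart X A (fullWord n k ++ (List.finRange n).take ((i : ℕ) + 1))

end NullDecomposition

/-! Everything reduces to $A_{w^m}=\emptyset$. The sets $A_{w^k1\cdots i}$ decrease along the word,
the pieces collect the successive differences, and $B\setminus B_i$ meets every flow line of $X_i$
in time zero (`lineMeasure_diff_positivePart`). If the chain ends in the empty set, each point of
$A$ drops out at exactly one stage.

A point survives the last letter only if it flows, for a set of times of positive measure, to points
that survive the rest. Hence $p\notin A_{w^m}$ as soon as, for almost every first time, almost every
second time and so on, the broken flow line from $p$ along the reversed word ends outside $A$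
(`notMem_wordPart_of_eventually`). A $C^1$ map pulls a null set back to a null set where it is a
submersion (`measure_submersion_preimage_eq_zero`), so it is enough that the endpoint map is a
submersion for almost all times.

The flow of $X_y$ pushes $X_v$ to $X_{e^{-t\,\mathrm{ad}\,y}v}$ (`fderiv_flow_apply`). Thus, in the
left-invariant frame, the image of the differential contains the subspace `reach`, and the question
becomes linear algebra in $\mathfrak g$. By analyticity in each time, the dimension of `reach` is
generically maximal. With every further copy of the word the maximum grows, or it stalls forever
(`maxRank_append_le_of_le`). If it has stalled, an optimal `reach` contains the generators and is
invariant under their adjoint action (`maxRank_eq_finrank`), so it is all of $\mathfrak g$, because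
$V_1$ generates. Hence $m=\dim\mathfrak g$ copies suffice. -/

namespace NullDecomposition

open Filter

/-! ### Generic rank of analytic families of subspaces. -/

section AnalyticFamily

/-- A real analytic function on the line that does not vanish identically vanishes almost
nowhere. -/
theorem ae_ne_zero_of_analyticOnNhd {f : ℝ → ℝ} (hf : AnalyticOnNhd ℝ f Set.univ) {t₀ : ℝ}
    (h : f t₀ ≠ 0) : ∀ᵐ t, f t ≠ 0 := by
  have h1 := hf.preimage_zero_mem_codiscrete h
  have h2 := ae_restrict_le_codiscreteWithin (μ := (volume : Measure ℝ)) MeasurableSet.univ h1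
  rw [Measure.restrict_univ] at h2
  filter_upwards [h2] with t ht
  simpa using ht

variable {L : Type*} [NormedAddCommGroup L] [NormedSpace ℝ L] [FiniteDimensional ℝ L]

/-- The dimension of `S + B_t T`, for a linear family `B_t` that is analytic in `t`, is almost
everywhere at least what it is at a given parameter. -/
theorem ae_le_finrank_sup_map (S T : Submodule ℝ L) (B : ℝ → L →ₗ[ℝ] L)
    (hB : ∀ (v : L) (q : L →ₗ[ℝ] ℝ), AnalyticOnNhd ℝ (fun t => q (B t v)) Set.univ)
    {d : ℕ} {t₀ : ℝ} (h : d ≤ Module.finrank ℝ ↥(S ⊔ T.map (B t₀))) :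
    ∀ᵐ t, d ≤ Module.finrank ℝ ↥(S ⊔ T.map (B t)) := by
  obtain ⟨w, hw⟩ := exists_linearIndependent_of_le_finrank h
  have hw' : LinearIndependent ℝ (fun k => (w k : L)) :=
    hw.map' (Submodule.subtype _) (Submodule.ker_subtype _)
  have hmem : ∀ k, ∃ s ∈ S, ∃ y ∈ T, s + B t₀ y = (w k : L) := by
    intro k
    obtain ⟨s, hs, z, hz, hsz⟩ := Submodule.mem_sup.1 (w k).2
    obtain ⟨y, hy, rfl⟩ := hz
    exact ⟨s, hs, y, hy, hsz⟩
  choose s hs y hy hsy using hmem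
  let J : (Fin d → ℝ) →ₗ[ℝ] L := Fintype.linearCombination ℝ (fun k => (w k : L))
  have hJ : LinearMap.ker J = ⊥ := by
    rw [LinearMap.ker_eq_bot]
    exact linearIndependent_iff_injective_fintypeLinearCombination.1 hw'
  -- `Q` reads off coordinates along the `w k`, so the determinant below equals 1 at `t₀`; where it
  -- is nonzero, the `d` vectors stay independent.
  obtain ⟨Q, hQ⟩ := J.exists_leftInverse_of_injective hJ
  have hQw : ∀ k, Q (w k) = Pi.single k 1 := by
    intro k
    have : J (Pi.single k 1) = w k := by simp [J, Fintype.linearCombination_apply_single]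
    rw [← this]
    exact LinearMap.congr_fun hQ _
  let M : ℝ → Matrix (Fin d) (Fin d) ℝ := fun t => Matrix.of fun k => Q (s k + B t (y k))
  have hM : AnalyticOnNhd ℝ (fun t => (M t).det) Set.univ := by
    simp only [Matrix.det_apply']
    refine Finset.analyticOnNhd_fun_sum _ fun σ _ => ?_
    refine analyticOnNhd_const.mul (Finset.analyticOnNhd_fun_prod _ fun k _ => ?_)
    have e : (fun t => M t (σ k) k) = fun t => Q (s (σ k)) k + Q (B t (y (σ k))) k := by
      ext t; simp [M]
    rw [e]
    exact analyticOnNhd_const.add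
      (hB (y (σ k)) ((LinearMap.proj (R := ℝ) (φ := fun _ : Fin d => ℝ) k).comp Q))
  have h0 : (M t₀).det ≠ 0 := by
    have : M t₀ = 1 := by
      ext k j
      simp only [M, Matrix.of_apply, hsy, hQw, Matrix.one_apply, Pi.single_apply]
      simp [eq_comm]
    simp [this]
  filter_upwards [ae_ne_zero_of_analyticOnNhd hM h0] with t ht
  have hli : LinearIndependent ℝ (fun k => Q (s k + B t (y k))) :=
    Matrix.linearIndependent_rows_of_det_ne_zero ht
  have hli' : LinearIndependent ℝ (fun k => s k + B t (y k)) := LinearIndependent.of_comp Q hli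
  have hli'' : LinearIndependent ℝ (fun k => (⟨s k + B t (y k),
      Submodule.add_mem_sup (hs k) (Submodule.mem_map_of_mem (hy k))⟩ : ↥(S ⊔ T.map (B t)))) :=
    LinearIndependent.of_comp (Submodule.subtype _) hli'
  simpa using hli''.fintype_card_le_finrank

end AnalyticFamily

/-! ### Iterated almost-everywhere quantifiers over words. -/

section TimesFilter

variable {ι : Type*}

/-- The filter, on lists of pairs of a letter and a time that spell the word `w`, of the properties
that hold for almost every first time, almost every second time, and so on. -/
noncomputable def timesFilter : List ι → Filter (List (ι × ℝ))
  | [] => pure []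
  | i :: w => (ae volume).bind fun t => (timesFilter w).map (List.cons (i, t))

theorem eventually_timesFilter_nil {P : List (ι × ℝ) → Prop} :
    (∀ᶠ l in timesFilter [], P l) ↔ P [] := by
  simp [timesFilter]

theorem eventually_timesFilter_cons {i : ι} {w : List ι} {P : List (ι × ℝ) → Prop} :
    (∀ᶠ l in timesFilter (i :: w), P l) ↔ ∀ᵐ t : ℝ, ∀ᶠ l in timesFilter w, P ((i, t) :: l) := by
  simp only [timesFilter, eventually_bind, eventually_map]

theorem eventually_timesFilter_append {u w : List ι} {P : List (ι × ℝ) → Prop} :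
    (∀ᶠ l in timesFilter (u ++ w), P l) ↔
      ∀ᶠ a in timesFilter u, ∀ᶠ b in timesFilter w, P (a ++ b) := by
  induction u generalizing P with
  | nil => simp [eventually_timesFilter_nil]
  | cons i u ih =>
    simp only [List.cons_append, eventually_timesFilter_cons, ih]

theorem eventually_timesFilter_map_fst (w : List ι) :
    ∀ᶠ l in timesFilter w, l.map Prod.fst = w := by
  induction w with
  | nil => simp [eventually_timesFilter_nil]
  | cons i w ih =>
    rw [eventually_timesFilter_cons]
    refine Eventually.of_forall fun t => ?_
    filter_upwards [ih] with l hl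
    simp [hl]

instance timesFilter_neBot (w : List ι) : (timesFilter w).NeBot := by
  refine ⟨fun h => ?_⟩
  have : ∀ᶠ l in timesFilter w, False := by rw [h]; exact eventually_bot
  clear h
  induction w with
  | nil => exact eventually_timesFilter_nil.1 this
  | cons i w ih =>
    rw [eventually_timesFilter_cons] at this
    obtain ⟨t, ht⟩ := this.exists
    exact ih ht

end TimesFilter

/-! ### Directions reached along a word. -/

section Reach

theorem exp_neg_mul_exp {R : Type*} [NormedRing R] [NormedAlgebra ℝ R] [CompleteSpace R] (r : R) :
    NormedSpace.exp (-r) * NormedSpace.exp r = 1 := by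
  let : NormedAlgebra ℚ R := NormedAlgebra.restrictScalars ℚ ℝ R
  rw [← NormedSpace.exp_add_of_commute (Commute.neg_left (Commute.refl _)), neg_add_cancel,
    NormedSpace.exp_zero]

variable {ι L : Type*} [NormedAddCommGroup L] [NormedSpace ℝ L] (x : ι → L) (a : ι → L →L[ℝ] L)

/-- The product of the operators `exp (-t aᵢ)` over a list of pairs `(i, t)`, the first one being
applied first. -/
noncomputable def transport : List (ι × ℝ) → L →L[ℝ] L
  | [] => ContinuousLinearMap.id ℝ L
  | p :: l => (transport l).comp (NormedSpace.exp (-p.2 • a p.1))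

/-- The span of the vectors `xᵢ`, each one transported by the part of the list after it. -/
noncomputable def reach : List (ι × ℝ) → Submodule ℝ L
  | [] => ⊥
  | p :: l => Submodule.span ℝ {transport a l (x p.1)} ⊔ reach l

@[simp] theorem transport_nil : transport a [] = ContinuousLinearMap.id ℝ L := rfl

theorem transport_cons (p : ι × ℝ) (l : List (ι × ℝ)) :
    transport a (p :: l) = (transport a l).comp (NormedSpace.exp (-p.2 • a p.1)) := rfl

@[simp] theorem reach_nil : reach x a [] = ⊥ := rfl

theorem reach_cons (p : ι × ℝ) (l : List (ι × ℝ)) :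
    reach x a (p :: l) = Submodule.span ℝ {transport a l (x p.1)} ⊔ reach x a l := rfl

theorem transport_append (l l' : List (ι × ℝ)) :
    transport a (l ++ l') = (transport a l').comp (transport a l) := by
  induction l with
  | nil => ext; simp
  | cons p l ih => rw [List.cons_append, transport_cons, ih, transport_cons]; rfl

theorem reach_append (l l' : List (ι × ℝ)) :
    reach x a (l ++ l') = (reach x a l).map (transport a l' : L →ₗ[ℝ] L) ⊔ reach x a l' := by
  induction l with
  | nil => simp
  | cons p l ih =>
    rw [List.cons_append, reach_cons, ih, reach_cons, Submodule.map_sup, Submodule.map_span,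
      transport_append, sup_assoc]
    simp

theorem transport_zero (w : List ι) : transport a (w.map fun i => (i, (0 : ℝ))) = .id ℝ L := by
  induction w with
  | nil => simp
  | cons i w ih =>
    rw [List.map_cons, transport_cons, ih]
    simp only [neg_zero, zero_smul, NormedSpace.exp_zero]
    rfl

theorem mem_reach_zero {w : List ι} {i : ι} (hi : i ∈ w) :
    x i ∈ reach x a (w.map fun i => (i, (0 : ℝ))) := by
  induction w with
  | nil => simp at hi
  | cons j w ih =>
    rw [List.map_cons, reach_cons, transport_zero]
    rcases List.mem_cons.1 hi with rfl | hi
    · exact Submodule.mem_sup_left (Submodule.mem_span_singleton_self _)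
    · exact Submodule.mem_sup_right (ih hi)

variable [FiniteDimensional ℝ L]

theorem transport_injective (l : List (ι × ℝ)) : Function.Injective (transport a l) := by
  induction l with
  | nil => exact fun _ _ h => h
  | cons p l ih =>
    rw [transport_cons, ContinuousLinearMap.coe_comp]
    refine ih.comp fun u v h => ?_
    have : CompleteSpace L := FiniteDimensional.complete ℝ L
    have key : (NormedSpace.exp (-(-p.2 • a p.1)) : L →L[ℝ] L) * NormedSpace.exp (-p.2 • a p.1) =
        1 := exp_neg_mul_exp _
    have key' : ∀ z, (NormedSpace.exp (-(-p.2 • a p.1)) : L →L[ℝ] L)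
        ((NormedSpace.exp (-p.2 • a p.1) : L →L[ℝ] L) z) = z :=
      fun z => DFunLike.congr_fun key z
    rw [← key' u, h, key' v]

theorem finrank_map_transport (l : List (ι × ℝ)) (S : Submodule ℝ L) :
    Module.finrank ℝ ↥(S.map (transport a l : L →ₗ[ℝ] L)) = Module.finrank ℝ S :=
  ((Submodule.equivMapOfInjective _ (transport_injective a l) S).finrank_eq).symm

end Reach
end NullDecomposition

namespace NullDecomposition

open Filter

/-! ### Growth and stabilization of the maximal rank. -/

section MaxRank

variable {ι L : Type*} [NormedAddCommGroup L] [NormedSpace ℝ L] [FiniteDimensional ℝ L]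
  (x : ι → L) (a : ι → L →L[ℝ] L)

theorem analyticOnNhd_exp_smul_apply (A C : L →L[ℝ] L) (v : L) (q : L →ₗ[ℝ] ℝ) :
    AnalyticOnNhd ℝ (fun t : ℝ => q (C ((NormedSpace.exp (-t • A) : L →L[ℝ] L) v))) Set.univ := by
  intro t _
  have : CompleteSpace L := FiniteDimensional.complete ℝ L
  have h1 : AnalyticAt ℝ (fun t : ℝ => -t • A) t := by fun_prop
  have h2 : AnalyticAt ℝ (fun t : ℝ => (NormedSpace.exp (-t • A) : L →L[ℝ] L)) t :=
    AnalyticAt.comp (f := fun t : ℝ => -t • A) (NormedSpace.exp_analytic (𝕂 := ℝ) _) h1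
  let Λ : (L →L[ℝ] L) →L[ℝ] ℝ :=
    (q.toContinuousLinearMap.comp C).comp (ContinuousLinearMap.apply ℝ L v)
  exact (Λ.analyticAt _).comp h2

/-- The times are made generic one by one from the left: `l'` holds those already chosen, and the
later ones keep their special values until their turn. -/
theorem eventually_le_finrank_reach_append {d : ℕ} (l' l : List (ι × ℝ))
    (h : d ≤ Module.finrank ℝ (reach x a (l' ++ l))) :
    ∀ᶠ b in timesFilter (l.map Prod.fst), d ≤ Module.finrank ℝ (reach x a (l' ++ b)) := by
  induction l generalizing l' with
  | nil => simpa [eventually_timesFilter_nil] using h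
  | cons p l ih =>
    obtain ⟨i, t₀⟩ := p
    have key : ∀ t : ℝ, reach x a (l' ++ (i, t) :: l) = reach x a ((i, t) :: l) ⊔
        (reach x a l').map ((transport a l : L →ₗ[ℝ] L) ∘ₗ
          ((NormedSpace.exp (-t • a i) : L →L[ℝ] L) : L →ₗ[ℝ] L)) := by
      intro t
      rw [reach_append, sup_comm, transport_cons]
      rfl
    -- A vector is transported only by the part of the list after it, so the time `t` acts on the
    -- contribution of `l'` alone.
    have key' : ∀ t : ℝ, reach x a ((i, t) :: l) = reach x a ((i, t₀) :: l) := fun t => rfl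
    rw [List.map_cons, eventually_timesFilter_cons]
    rw [key t₀, key' t₀] at h
    have hB := ae_le_finrank_sup_map (reach x a ((i, t₀) :: l)) (reach x a l')
      (fun t => (transport a l : L →ₗ[ℝ] L) ∘ₗ
          ((NormedSpace.exp (-t • a i) : L →L[ℝ] L) : L →ₗ[ℝ] L))
      (fun v q => analyticOnNhd_exp_smul_apply (a i) (transport a l) v q) h
    filter_upwards [hB] with t ht
    have := ih (l' ++ [(i, t)]) (by
      rw [List.append_assoc, List.singleton_append, key, key']
      exact ht)
    filter_upwards [this] with b hb
    rwa [List.append_assoc, List.singleton_append] at hb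

theorem eventually_le_finrank_reach {d : ℕ} {w : List ι} {l : List (ι × ℝ)}
    (hl : l.map Prod.fst = w) (h : d ≤ Module.finrank ℝ (reach x a l)) :
    ∀ᶠ b in timesFilter w, d ≤ Module.finrank ℝ (reach x a b) := by
  have := eventually_le_finrank_reach_append x a [] l h
  rwa [hl] at this

/-- The largest dimension of `reach x a l` among the lists `l` that spell the word `w`. -/
noncomputable def maxRank (w : List ι) : ℕ :=
  sSup {d | ∃ l : List (ι × ℝ), l.map Prod.fst = w ∧ Module.finrank ℝ (reach x a l) = d}

variable {x a}

theorem bddAbove_finrank_reach (w : List ι) : BddAbove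
    {d | ∃ l : List (ι × ℝ), l.map Prod.fst = w ∧ Module.finrank ℝ (reach x a l) = d} :=
  ⟨Module.finrank ℝ L, by rintro _ ⟨l, -, rfl⟩; exact Submodule.finrank_le _⟩

theorem finrank_reach_le_maxRank {w : List ι} {l : List (ι × ℝ)} (hl : l.map Prod.fst = w) :
    Module.finrank ℝ (reach x a l) ≤ maxRank x a w :=
  le_csSup (bddAbove_finrank_reach w) ⟨l, hl, rfl⟩

theorem exists_finrank_reach_eq_maxRank (w : List ι) :
    ∃ l : List (ι × ℝ), l.map Prod.fst = w ∧ Module.finrank ℝ (reach x a l) = maxRank x a w :=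
  Nat.sSup_mem (s := {d | ∃ l : List (ι × ℝ), l.map Prod.fst = w ∧
      Module.finrank ℝ (reach x a l) = d})
    ⟨_, w.map (fun i => (i, (0 : ℝ))), by simp [Function.comp_def], rfl⟩ (bddAbove_finrank_reach w)

theorem maxRank_le_finrank (w : List ι) : maxRank x a w ≤ Module.finrank ℝ L := by
  obtain ⟨l, -, h⟩ := exists_finrank_reach_eq_maxRank (x := x) (a := a) w
  exact h ▸ Submodule.finrank_le _

theorem eventually_finrank_reach_eq_maxRank (w : List ι) :
    ∀ᶠ l in timesFilter w, Module.finrank ℝ (reach x a l) = maxRank x a w := by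
  obtain ⟨l, hl, h⟩ := exists_finrank_reach_eq_maxRank (x := x) (a := a) w
  filter_upwards [eventually_le_finrank_reach x a hl h.ge, eventually_timesFilter_map_fst w]
    with b hb hb'
  exact le_antisymm (finrank_reach_le_maxRank hb') hb

theorem maxRank_le_maxRank_append (u w : List ι) : maxRank x a w ≤ maxRank x a (u ++ w) := by
  obtain ⟨l, hl, h⟩ := exists_finrank_reach_eq_maxRank (x := x) (a := a) w
  rw [← h]
  refine le_trans (Submodule.finrank_mono ?_) (finrank_reach_le_maxRank
    (l := u.map (fun i => (i, (0 : ℝ))) ++ l) (by simp [hl, Function.comp_def]))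
  rw [reach_append]
  exact le_sup_right

/-- If prepending `u` to `w` does not increase the largest rank, then prepending `u` to `w ++ v`
does not increase it either. -/
theorem maxRank_append_le_of_le {u w v : List ι} (h : maxRank x a (u ++ w) ≤ maxRank x a w) :
    maxRank x a (u ++ (w ++ v)) ≤ maxRank x a (w ++ v) := by
  have h1 := eventually_finrank_reach_eq_maxRank (x := x) (a := a) (u ++ (w ++ v))
  rw [eventually_timesFilter_append] at h1
  obtain ⟨s, hs, hs'⟩ := (h1.and (eventually_timesFilter_map_fst u)).exists
  rw [eventually_timesFilter_append] at hs
  obtain ⟨t, ⟨ht, ht'⟩, ht''⟩ := ((hs.and (eventually_timesFilter_map_fst w)).and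
    (eventually_finrank_reach_eq_maxRank (x := x) (a := a) w)).exists
  obtain ⟨b, hb, hb'⟩ := (ht.and (eventually_timesFilter_map_fst v)).exists
  have hle : reach x a t ≤ reach x a (s ++ t) := by rw [reach_append]; exact le_sup_right
  -- At generic times `t` already attains the maximum for `w`, so prepending `s` adds nothing; this
  -- equality survives transport along `b`.
  have heq : reach x a t = reach x a (s ++ t) := by
    refine Submodule.eq_of_le_of_finrank_le hle ?_
    rw [ht'']
    exact (finrank_reach_le_maxRank (by simp [hs', ht'])).trans h
  rw [← hb, ← List.append_assoc, reach_append, ← heq, ← reach_append]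
  exact finrank_reach_le_maxRank (by simp [ht', hb'])

/-- If the largest rank for a word `w` is also that for `w ++ u ++ w`, where `u` contains all
letters, then the largest rank is the full dimension. -/
theorem maxRank_eq_finrank {u w : List ι} (hu : ∀ i, i ∈ u)
    (hgen : ∀ F : Submodule ℝ L, (∀ i, x i ∈ F) → (∀ i, ∀ v ∈ F, a i v ∈ F) → F = ⊤)
    (h : maxRank x a (w ++ u ++ w) ≤ maxRank x a w) :
    maxRank x a w = Module.finrank ℝ L := by
  obtain ⟨t, ht, hr⟩ := exists_finrank_reach_eq_maxRank (x := x) (a := a) w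
  set F := reach x a t with hF
  -- By `h` there is no room for growth: whatever times are put in front of the optimal list `t`,
  -- the reached space stays `F`.
  have hsub : ∀ l : List (ι × ℝ), (∃ u', u'.IsSuffix (w ++ u) ∧ l.map Prod.fst = u') →
      F = reach x a (l ++ t) := by
    rintro l ⟨u', ⟨z, hz⟩, hl⟩
    refine Submodule.eq_of_le_of_finrank_le (by rw [reach_append]; exact le_sup_right) ?_
    rw [hr]
    refine (finrank_reach_le_maxRank (w := u' ++ w) (by simp [hl, ht])).trans (le_trans ?_ h)
    rw [← hz, List.append_assoc]
    exact maxRank_le_maxRank_append _ _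
  have hmap : ∀ l : List (ι × ℝ), (∃ u', u'.IsSuffix (w ++ u) ∧ l.map Prod.fst = u') →
      (reach x a l).map (transport a t : L →ₗ[ℝ] L) ≤ F := by
    intro l hl
    conv_rhs => rw [hsub l hl]
    rw [reach_append]
    exact le_sup_left
  -- `F` is invariant under the transport along `t`
  obtain ⟨z, hz⟩ : ∃ z : List (ι × ℝ), z = u.map fun i => (i, (0 : ℝ)) := ⟨_, rfl⟩
  have hzf : z.map Prod.fst = u := by simp [hz, Function.comp_def]
  have htz : (reach x a t).map (transport a t : L →ₗ[ℝ] L) = F := by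
    refine Submodule.eq_of_le_of_finrank_le ?_ (by rw [finrank_map_transport])
    refine le_trans (Submodule.map_mono ?_)
      (hmap (t ++ z) ⟨w ++ u, List.suffix_rfl, by simp [ht, hzf]⟩)
    rw [reach_append, hz, transport_zero]
    simp
  have hback : ∀ S : Submodule ℝ L, S.map (transport a t : L →ₗ[ℝ] L) ≤ F → S ≤ F := by
    intro S hS
    rw [← htz] at hS
    exact (Submodule.map_le_map_iff_of_injective (transport_injective a t) _ _).1 hS
  have hx : ∀ i, x i ∈ F := by
    intro i
    refine hback _ (hmap z ⟨u, List.suffix_append _ _, hzf⟩) ?_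
    rw [hz]
    exact mem_reach_zero x a (hu i)
  have hexp : ∀ i (s : ℝ), ∀ v ∈ F, (NormedSpace.exp (-s • a i) : L →L[ℝ] L) v ∈ F := by
    intro i s v hv
    obtain ⟨u₁, u₂, hu₁⟩ := List.append_of_mem (hu i)
    -- All letters of `u` get time 0 except one occurrence of `i`, which isolates a single
    -- exponential.
    let y : List (ι × ℝ) := u₁.map (fun i => (i, (0 : ℝ))) ++ (i, s) :: u₂.map fun i => (i, (0 : ℝ))
    have hy : y.map Prod.fst = u := by simp [y, hu₁, Function.comp_def]
    have hyt : transport a y = NormedSpace.exp (-s • a i) := by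
      simp only [y, transport_append, transport_cons, transport_zero]
      ext; rfl
    refine hback ((reach x a t).map (transport a y : L →ₗ[ℝ] L)) ?_ ?_
    · refine le_trans (Submodule.map_mono ?_)
        (hmap (t ++ y) ⟨w ++ u, List.suffix_rfl, by simp [ht, hy]⟩)
      rw [reach_append]
      exact le_sup_left
    · rw [hyt]
      exact Submodule.mem_map_of_mem hv
  have ha : ∀ i, ∀ v ∈ F, a i v ∈ F := by
    intro i v hv
    have : CompleteSpace L := FiniteDimensional.complete ℝ L
    -- Invariance under the one-parameter group passes to its generator, since the closed subspace
    -- `F` contains the limit of the difference quotients.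
    have h1 : HasDerivAt (fun s : ℝ => (NormedSpace.exp (s • a i) : L →L[ℝ] L)) (a i) 0 := by
      have := hasDerivAt_exp_smul_const (𝕂 := ℝ) (a i) 0
      rwa [zero_smul, NormedSpace.exp_zero, one_mul] at this
    have h2 : HasDerivAt (fun s : ℝ => (NormedSpace.exp (s • a i) : L →L[ℝ] L) v) (a i v) 0 :=
      ((ContinuousLinearMap.apply ℝ L v).hasFDerivAt.comp_hasDerivAt (0 : ℝ) h1)
    have h3 := h2.tendsto_slope
    refine F.closed_of_finiteDimensional.mem_of_tendsto h3 (Eventually.of_forall fun s => ?_)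
    have h4 : ∀ s : ℝ, (NormedSpace.exp (s • a i) : L →L[ℝ] L) v ∈ F := fun s => by
      simpa using hexp i (-s) v hv
    exact F.smul_mem _ (F.sub_mem (h4 _) (h4 _))
  rw [← hr, hgen F hx ha, finrank_top]

/-- For almost all times along the `d`-fold concatenation of a word with all letters, where `d` is
the dimension, everything is reached. -/
theorem eventually_reach_eq_top {w : List ι} (hw : ∀ i, i ∈ w)
    (hgen : ∀ F : Submodule ℝ L, (∀ i, x i ∈ F) → (∀ i, ∀ v ∈ F, a i v ∈ F) → F = ⊤) :
    ∀ᶠ l in timesFilter (List.replicate (Module.finrank ℝ L) w).flatten, reach x a l = ⊤ := by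
  set D := Module.finrank ℝ L with hD
  set r : ℕ → ℕ := fun k => maxRank x a (List.replicate k w).flatten with hr
  have hsucc : ∀ k, (List.replicate (k + 1) w).flatten = w ++ (List.replicate k w).flatten := by
    intro k; simp [List.replicate_succ]
  have hadd : ∀ k j, (List.replicate (k + j) w).flatten =
      (List.replicate k w).flatten ++ (List.replicate j w).flatten := by
    intro k j; rw [List.replicate_add, List.flatten_append]
  have hstab : ∀ k, r (k + 1) ≤ r k → r (k + 2) ≤ r (k + 1) := by
    intro k hk
    simp only [hr] at hk ⊢
    have e : (List.replicate (k + 1) w).flatten = (List.replicate k w).flatten ++ w := by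
      rw [hadd]; simp
    -- One copy is split off at each end: the left one is the prepended word, the right one the
    -- common tail `v` of `maxRank_append_le_of_le`.
    have e2 : (List.replicate (k + 2) w).flatten = w ++ ((List.replicate k w).flatten ++ w) := by
      rw [hsucc (k + 1), e]
    rw [e2, e]
    rw [hsucc] at hk
    exact maxRank_append_le_of_le hk
  have hconst : ∀ k, r (k + 1) ≤ r k → ∀ j, r (k + j) ≤ r k := by
    intro k hk
    have h1 : ∀ j, r (k + j + 1) ≤ r (k + j) := by
      intro j
      induction j with
      | zero => exact hk
      | succ j ih => exact hstab _ ih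
    intro j
    induction j with
    | zero => exact le_rfl
    | succ j ih => exact (h1 j).trans ih
  have hmono : Monotone r := by
    refine monotone_nat_of_le_succ fun k => ?_
    simp only [hr, hsucc]
    exact maxRank_le_maxRank_append _ _
  -- Either the rank stalls at some `k ≤ D` and stays constant, or it grows at each of these steps
  -- and is already at least `D`. The `D + 1 + D` copies are `D` copies on either side of one middle
  -- copy.
  have hle : r (D + 1 + D) ≤ r D := by
    by_cases hk : ∃ k ≤ D, r (k + 1) ≤ r k
    · obtain ⟨k, hkD, hk⟩ := hk
      calc r (D + 1 + D) = r (k + (D + 1 + D - k)) := by congr 1; omega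
        _ ≤ r k := hconst k hk _
        _ ≤ r D := hmono hkD
    · push Not at hk
      have h1 : ∀ k ≤ D, k ≤ r k := by
        intro k
        induction k with
        | zero => intro; exact Nat.zero_le _
        | succ k ih =>
          intro h
          exact Nat.succ_le_of_lt (lt_of_le_of_lt (ih (by omega)) (hk k (by omega)))
      exact (maxRank_le_finrank _).trans (h1 D le_rfl)
  have hfull : r D = D := by
    refine maxRank_eq_finrank (u := w) hw hgen ?_
    have e : (List.replicate (D + 1 + D) w).flatten =
        (List.replicate D w).flatten ++ w ++ (List.replicate D w).flatten := by
      rw [hadd, hadd]; simp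
    simp only [hr] at hle
    rwa [e] at hle
  filter_upwards [eventually_finrank_reach_eq_maxRank (x := x) (a := a)
    (List.replicate D w).flatten] with l hl
  exact Submodule.eq_top_of_finrank_eq (hl.trans hfull)

end MaxRank
end NullDecomposition

namespace NullDecomposition

open Filter

/-! ### Null sets under submersions. -/

section Submersion

variable {T E : Type*} [NormedAddCommGroup T] [NormedSpace ℝ T] [FiniteDimensional ℝ T]
  [MeasurableSpace T] [BorelSpace T] [NormedAddCommGroup E] [NormedSpace ℝ E]
  [FiniteDimensional ℝ E] [MeasurableSpace E] [BorelSpace E]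

/-- The preimage of a null set under a `C¹` map is null on the set of points at which the map is a
submersion. -/
theorem measure_submersion_preimage_eq_zero (μ : Measure T) [μ.IsAddHaarMeasure] (ν : Measure E)
    [ν.IsAddHaarMeasure] {f : T → E} (hf : ContDiff ℝ 1 f) {A : Set E} (hA : MeasurableSet A)
    (hA0 : ν A = 0) :
    μ {t | Function.Surjective (fderiv ℝ f t) ∧ f t ∈ A} = 0 := by
  refine measure_null_of_locally_null _ fun t₀ ht₀ => ?_
  have : CompleteSpace T := FiniteDimensional.complete ℝ T
  obtain ⟨hsurj, -⟩ := ht₀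
  set f' := fderiv ℝ f t₀ with hf'
  obtain ⟨s, hs⟩ := (f' : T →ₗ[ℝ] E).exists_rightInverse_of_surjective
    (LinearMap.range_eq_top.2 hsurj)
  have hs' : ∀ e, f' (s e) = e := fun e => LinearMap.congr_fun hs e
  let S : E →L[ℝ] T := s.toContinuousLinearMap
  -- The correction by the right inverse `S` straightens `f`: `f' ∘ g = f`, and `g` has identity
  -- derivative at `t₀`, so it is a local diffeomorphism.
  let g : T → T := fun t => t + S (f t - f' t)
  have hg : ContDiff ℝ 1 g := by fun_prop
  have hfg : ∀ t, f' (g t) = f t := by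
    intro t
    change f' (t + s (f t - f' t)) = f t
    rw [map_add, hs']
    abel
  have hg' : HasFDerivAt g ((ContinuousLinearEquiv.refl ℝ T : T ≃L[ℝ] T) : T →L[ℝ] T) t₀ := by
    have h1 : HasFDerivAt f f' t₀ := (hf.differentiable one_ne_zero t₀).hasFDerivAt
    have h2 := (hasFDerivAt_id t₀).add (S.hasFDerivAt.comp t₀ (h1.sub f'.hasFDerivAt))
    rw [sub_self, ContinuousLinearMap.comp_zero, add_zero] at h2
    exact h2
  set e := hg.contDiffAt.toOpenPartialHomeomorph g hg' one_ne_zero with he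
  have hsrc : t₀ ∈ e.source := hg.contDiffAt.mem_toOpenPartialHomeomorph_source hg' one_ne_zero
  have hsymm : ContDiffAt ℝ 1 e.symm (g t₀) := hg.contDiffAt.to_localInverse hg' one_ne_zero
  have hev : ∀ᶠ y in nhds (g t₀), ContDiffAt ℝ 1 e.symm y := hsymm.eventually (by simp)
  refine ⟨e.source ∩ g ⁻¹' {y | ContDiffAt ℝ 1 e.symm y} ∩ f ⁻¹' A, ?_, ?_⟩
  · rw [mem_nhdsWithin_iff_eventually]
    filter_upwards [e.open_source.mem_nhds hsrc, hg.continuous.continuousAt.eventually hev]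
      with t h1 h2 h3
    exact ⟨⟨h1, h2⟩, h3.2⟩
  · have hnull : μ (f' ⁻¹' A) = 0 := by
      have := (ae_comp_linearMap_mem_iff (μ := μ) (ν := ν) (L := (f' : T →ₗ[ℝ] E)) hsurj
        hA.compl).2 (measure_eq_zero_iff_ae_notMem.1 hA0)
      rw [measure_eq_zero_iff_ae_notMem]
      exact this
    refine measure_mono_null (t := e.symm '' ({y | ContDiffAt ℝ 1 e.symm y} ∩ f' ⁻¹' A)) ?_ ?_
    · rintro t ⟨⟨h1, h2⟩, h3⟩
      refine ⟨g t, ⟨h2, ?_⟩, e.left_inv h1⟩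
      change f' (g t) ∈ A
      rwa [hfg]
    · refine addHaar_image_eq_zero_of_differentiableOn_of_addHaar_eq_zero μ ?_
        (measure_mono_null Set.inter_subset_right hnull)
      rintro y ⟨hy, -⟩
      exact (ContDiffAt.differentiableAt (n := 1) hy one_ne_zero).differentiableWithinAt

end Submersion

/-! ### The endpoint map of broken flow lines, and Fubini. -/

section Endpoint

variable {ι E : Type*}

/-- The list of pairs that spells the word `w` and has the given times. -/
def timed : (w : List ι) → (Fin w.length → ℝ) → List (ι × ℝ)
  | [], _ => []
  | i :: w, t => (i, t 0) :: timed w (Fin.tail t)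

/-- A property of almost all vectors of times holds for almost every first time, almost every
second time, and so on. -/
theorem eventually_timesFilter_of_ae (w : List ι) {P : List (ι × ℝ) → Prop}
    (h : ∀ᵐ t : Fin w.length → ℝ, P (timed w t)) : ∀ᶠ l in timesFilter w, P l := by
  induction w generalizing P with
  | nil =>
    rw [eventually_timesFilter_nil]
    obtain ⟨t, ht⟩ := h.exists
    exact ht
  | cons i w ih =>
    rw [eventually_timesFilter_cons]
    have hmp := (volume_preserving_piFinSuccAbove (fun _ : Fin (w.length + 1) => ℝ) 0).symm
    have h1 : ∀ᵐ p : ℝ × (Fin w.length → ℝ), P ((i, p.1) :: timed w p.2) := by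
      have h2 := hmp.quasiMeasurePreserving.ae h
      filter_upwards [h2] with p hp
      simpa [timed, MeasurableEquiv.piFinSuccAbove, Fin.consEquiv] using hp
    filter_upwards [Measure.ae_ae_of_ae_prod h1] with t ht
    exact ih ht

/-- The endpoint of the concatenation of the flow lines given by a list of letters and times. -/
def endpoint (H : ι → ℝ × E → E) : List (ι × ℝ) → E → E
  | [], p => p
  | q :: l, p => endpoint H l (H q.1 (q.2, p))

variable [NormedAddCommGroup E] [NormedSpace ℝ E]

theorem contDiff_endpoint_timed {n : WithTop ℕ∞} {H : ι → ℝ × E → E} (hH : ∀ i, ContDiff ℝ n (H i))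
    (w : List ι) :
    ContDiff ℝ n (fun q : E × (Fin w.length → ℝ) => endpoint H (timed w q.2) q.1) := by
  induction w with
  | nil => exact contDiff_fst
  | cons i w ih =>
    have h1 : ContDiff ℝ n (fun q : E × (Fin (i :: w).length → ℝ) => H i (q.2 0, q.1)) := by
      refine (hH i).comp (ContDiff.prodMk ?_ contDiff_fst)
      exact (contDiff_apply ℝ ℝ (0 : Fin (w.length + 1))).comp contDiff_snd
    have h2 : ContDiff ℝ n (fun q : E × (Fin (i :: w).length → ℝ) =>
        (Fin.tail q.2 : Fin w.length → ℝ)) := by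
      refine contDiff_pi.2 fun j => ?_
      exact (contDiff_apply ℝ ℝ (Fin.succ j : Fin (w.length + 1))).comp contDiff_snd
    exact ih.comp (h1.prodMk h2)

end Endpoint
end NullDecomposition

namespace NullDecomposition

open Filter

/-! ### Uniqueness for linear differential equations. -/

section LinearODE

variable {E : Type*} [NormedAddCommGroup E] [NormedSpace ℝ E]

/-- Uniqueness of global solutions of a linear differential equation with continuous
coefficients. -/
theorem linearODE_solution_unique {M : ℝ → E →L[ℝ] E} (hM : Continuous M) {f g : ℝ → E}
    (hf : ∀ t, HasDerivAt f (M t (f t)) t) (hg : ∀ t, HasDerivAt g (M t (g t)) t)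
    (h0 : f 0 = g 0) : f = g := by
  ext t
  obtain ⟨K, hK⟩ := (isCompact_Icc (a := -(|t| + 1)) (b := |t| + 1)).exists_bound_of_continuousOn
    hM.continuousOn
  have habs := abs_le.1 (le_refl |t|)
  have hsol := ODE_solution_unique_of_mem_Ioo (v := fun t z => M t z) (s := fun _ => Set.univ)
    (K := K.toNNReal) (a := -(|t| + 1)) (b := |t| + 1) (t₀ := 0) (f := f) (g := g) ?_ ?_
    (fun t _ => ⟨hf t, trivial⟩) (fun t _ => ⟨hg t, trivial⟩) h0
  · exact hsol ⟨by linarith, by linarith⟩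
  · intro s hs
    have h1 : ‖M s‖₊ ≤ K.toNNReal := by
      rw [← norm_toNNReal]
      exact Real.toNNReal_le_toNNReal (hK s ⟨hs.1.le, hs.2.le⟩)
    exact ((M s).lipschitz.weaken h1).lipschitzOnWith
  · constructor <;> linarith [abs_nonneg t]

end LinearODE

/-! ### How a flow transports the left-invariant frame. -/

section Frame

variable {L E : Type*} [NormedAddCommGroup L] [NormedSpace ℝ L] [FiniteDimensional ℝ L]
  [NormedAddCommGroup E] [NormedSpace ℝ E]
  {X : L →ₗ[ℝ] E → E}

theorem hasDerivAt_linear_family (hX : ∀ v, Differentiable ℝ (X v)) {c : ℝ → L} {γ : ℝ → E}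
    {c' : L} {γ' : E} {t : ℝ} (hc : HasDerivAt c c' t) (hγ : HasDerivAt γ γ' t) :
    HasDerivAt (fun s => X (c s) (γ s)) (X c' (γ t) + fderiv ℝ (X (c t)) (γ t) γ') t := by
  let B := Module.finBasis ℝ L
  have hexp : ∀ (u : L) (q : E), X u q = ∑ k, B.repr u k • X (B k) q := by
    intro u q
    conv_lhs => rw [← B.sum_repr u, map_sum, Finset.sum_apply]
    exact Finset.sum_congr rfl fun k _ => by rw [map_smul]; rfl
  have hfd : fderiv ℝ (X (c t)) (γ t) = ∑ k, B.repr (c t) k • fderiv ℝ (X (B k)) (γ t) := by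
    have : X (c t) = fun q => ∑ k, B.repr (c t) k • X (B k) q := by ext q; exact hexp _ _
    rw [this, fderiv_fun_sum fun k _ => ((hX (B k) _).fun_const_smul _)]
    exact Finset.sum_congr rfl fun k _ => fderiv_fun_const_smul (hX (B k) _) _
  have hk : ∀ k, HasDerivAt (fun s => B.repr (c s) k • X (B k) (γ s))
      (B.repr (c t) k • fderiv ℝ (X (B k)) (γ t) γ' + B.repr c' k • X (B k) (γ t)) t := by
    intro k
    have h1 : HasDerivAt (fun s => B.repr (c s) k) (B.repr c' k) t :=
      ((B.coord k).toContinuousLinearMap.hasFDerivAt.comp_hasDerivAt t hc)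
    have h2 : HasDerivAt (fun s => X (B k) (γ s)) (fderiv ℝ (X (B k)) (γ t) γ') t :=
      (hX (B k) _).hasFDerivAt.comp_hasDerivAt t hγ
    exact h1.smul h2
  have hsum := HasDerivAt.fun_sum (u := Finset.univ) fun k _ => hk k
  simp only [hexp (c _) (γ _)]
  convert hsum using 1
  rw [hexp, hfd, Finset.sum_add_distrib, add_comm]
  simp

/-- The flow of a vector field `X y` pushes `X v` forward to `X (exp (-t ad y) v)`. -/
theorem fderiv_flow_apply (hX : ∀ v, ContDiff ℝ 1 (X v)) {y : L} {A : L →L[ℝ] L}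
    (hA : ∀ v p, VectorField.lieBracket ℝ (X y) (X v) p = X (A v) p) {H : ℝ × E → E}
    (hH : ContDiff ℝ 2 H) (h0 : ∀ p, H (0, p) = p)
    (hflow : ∀ t p, HasDerivAt (fun s => H (s, p)) (X y (H (t, p))) t) (t : ℝ) (p : E) (v : L) :
    fderiv ℝ H (t, p) (0, X v p) =
      X ((NormedSpace.exp (-t • A) : L →L[ℝ] L) v) (H (t, p)) := by
  have : CompleteSpace L := FiniteDimensional.complete ℝ L
  have hHd : Differentiable ℝ H := hH.differentiable (by norm_num)
  have hDH : ContDiff ℝ 1 (fderiv ℝ H) := hH.fderiv_right (by norm_num)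
  have hDHd : Differentiable ℝ (fderiv ℝ H) := hDH.differentiable one_ne_zero
  have hXd : ∀ v, Differentiable ℝ (X v) := fun v => (hX v).differentiable one_ne_zero
  have hline : ∀ s : ℝ, HasDerivAt (fun s : ℝ => (s, p)) ((1 : ℝ), (0 : E)) s := fun s =>
    (hasDerivAt_id s).prodMk (hasDerivAt_const s p)
  have hpart : ∀ q : ℝ × E, fderiv ℝ H q (1, 0) = X y (H q) := by
    rintro ⟨s, q⟩
    have h1 := (hHd (s, q)).hasFDerivAt.comp_hasDerivAt s
      ((hasDerivAt_id s).prodMk (hasDerivAt_const s q))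
    exact h1.unique (hflow s q)
  have hcurve : Continuous fun s => H (s, p) := by fun_prop
  have hM : Continuous fun s => fderiv ℝ (X y) (H (s, p)) :=
    ((hX y).continuous_fderiv one_ne_zero).comp hcurve
  -- Both sides solve the flow equation linearized along the curve: the left one by symmetry of the
  -- second derivative, the right one because the bracket term cancels the derivative of the
  -- exponential.
  refine congrFun (linearODE_solution_unique hM (f := fun s => fderiv ℝ H (s, p) (0, X v p))
    (g := fun s => X ((NormedSpace.exp (-s • A) : L →L[ℝ] L) v) (H (s, p))) ?_ ?_ ?_) t
  · intro s
    have h1 : HasDerivAt (fun s => fderiv ℝ H (s, p) (0, X v p))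
        (fderiv ℝ (fderiv ℝ H) (s, p) (1, 0) (0, X v p)) s := by
      have h2 := (hDHd (s, p)).hasFDerivAt.comp_hasDerivAt s (hline s)
      exact (ContinuousLinearMap.apply ℝ E ((0 : ℝ), X v p)).hasFDerivAt.comp_hasDerivAt s h2
    have hsymm : IsSymmSndFDerivAt ℝ H (s, p) :=
      hH.contDiffAt.isSymmSndFDerivAt (by simp [minSmoothness_of_isRCLikeNormedField])
    rw [hsymm] at h1
    convert h1 using 1
    have h3 : HasFDerivAt (fun q => fderiv ℝ H q (1, 0))
        ((ContinuousLinearMap.apply ℝ E ((1 : ℝ), (0 : E))).comp (fderiv ℝ (fderiv ℝ H) (s, p)))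
        (s, p) :=
      (ContinuousLinearMap.apply ℝ E ((1 : ℝ), (0 : E))).hasFDerivAt.comp (s, p)
        (hDHd (s, p)).hasFDerivAt
    have h4 : HasFDerivAt (fun q => X y (H q)) ((fderiv ℝ (X y) (H (s, p))).comp
        (fderiv ℝ H (s, p))) (s, p) :=
      (hXd y _).hasFDerivAt.comp (s, p) (hHd _).hasFDerivAt
    simp only [hpart] at h3
    exact (DFunLike.congr_fun (h3.unique h4) ((0 : ℝ), X v p)).symm
  · intro s
    have h1 : HasDerivAt (fun s : ℝ => (NormedSpace.exp (-s • A) : L →L[ℝ] L))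
        (-(A * NormedSpace.exp (-s • A))) s := by
      have := (hasDerivAt_exp_smul_const' (𝕂 := ℝ) A (-s)).scomp s (hasDerivAt_neg s)
      rwa [neg_one_smul] at this
    have h2 : HasDerivAt (fun s : ℝ => (NormedSpace.exp (-s • A) : L →L[ℝ] L) v)
        (-(A ((NormedSpace.exp (-s • A) : L →L[ℝ] L) v))) s :=
      (ContinuousLinearMap.apply ℝ L v).hasFDerivAt.comp_hasDerivAt s h1
    convert hasDerivAt_linear_family hXd h2 (hflow s p) using 1
    set c := (NormedSpace.exp (-s • A) : L →L[ℝ] L) v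
    have h3 := hA c (H (s, p))
    rw [VectorField.lieBracket] at h3
    rw [map_neg, Pi.neg_apply, ← h3]
    abel
  · have h1 : HasFDerivAt (fun q => H (0, q)) ((fderiv ℝ H (0, p)).comp
        (ContinuousLinearMap.inr ℝ ℝ E)) p :=
      (hHd (0, p)).hasFDerivAt.comp p (hasFDerivAt_prodMk_right (0 : ℝ) p)
    simp only [h0] at h1
    have h2 := DFunLike.congr_fun (h1.unique (hasFDerivAt_id p)) (X v p)
    simp only [neg_zero, zero_smul, NormedSpace.exp_zero, h0]
    exact h2

end Frame

/-! ### The differential of the endpoint map. -/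

section EndpointDerivative

variable {ι L E : Type*} [NormedAddCommGroup L] [NormedSpace ℝ L] [FiniteDimensional ℝ L]
  [NormedAddCommGroup E] [NormedSpace ℝ E]
  {X : L →ₗ[ℝ] E → E} {x : ι → L} {a : ι → L →L[ℝ] L} {H : ι → ℝ × E → E}

theorem fderiv_endpoint_cons (hH : ∀ i, ContDiff ℝ 2 (H i)) (i : ι) (w : List ι) (p : E)
    (t : Fin (w.length + 1) → ℝ) (δ : E) (τ : Fin (w.length + 1) → ℝ) :
    fderiv ℝ (fun q : E × (Fin (i :: w).length → ℝ) => endpoint H (timed (i :: w) q.2) q.1)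
        (p, t) (δ, τ) =
      fderiv ℝ (fun q : E × (Fin w.length → ℝ) => endpoint H (timed w q.2) q.1)
        (H i (t 0, p), Fin.tail t) (fderiv ℝ (H i) (t 0, p) (τ 0, δ), Fin.tail τ) := by
  let P : E × (Fin (w.length + 1) → ℝ) →L[ℝ] ℝ × E :=
    ((ContinuousLinearMap.proj (R := ℝ) (φ := fun _ : Fin (w.length + 1) => ℝ) 0).comp
      (ContinuousLinearMap.snd ℝ E _)).prod (ContinuousLinearMap.fst ℝ E _)
  let Q : E × (Fin (w.length + 1) → ℝ) →L[ℝ] (Fin w.length → ℝ) :=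
    (ContinuousLinearMap.pi fun j : Fin w.length =>
      ContinuousLinearMap.proj (R := ℝ) (φ := fun _ : Fin (w.length + 1) => ℝ) j.succ).comp
      (ContinuousLinearMap.snd ℝ E _)
  have h1 : HasFDerivAt (fun q => (H i (P q), Q q)) (((fderiv ℝ (H i) (P (p, t))).comp P).prod Q)
      (p, t) :=
    ((((hH i).differentiable (by norm_num)) (P (p, t))).hasFDerivAt.comp (p, t)
      P.hasFDerivAt).prodMk Q.hasFDerivAt
  have h2 := (((contDiff_endpoint_timed hH w).differentiable (by norm_num))
    (H i (t 0, p), Fin.tail t)).hasFDerivAt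
  have h3 := HasFDerivAt.comp (p, t) (f := fun q => (H i (P q), Q q)) h2 h1
  exact DFunLike.congr_fun h3.fderiv (δ, τ)

theorem fderiv_endpoint_frame
    (hX : ∀ v, ContDiff ℝ 1 (X v))
    (ha : ∀ i v p, VectorField.lieBracket ℝ (X (x i)) (X v) p = X (a i v) p)
    (hH : ∀ i, ContDiff ℝ 2 (H i)) (h0 : ∀ i p, H i (0, p) = p)
    (hflow : ∀ i t p, HasDerivAt (fun s => H i (s, p)) (X (x i) (H i (t, p))) t)
    (w : List ι) (p : E) (t : Fin w.length → ℝ) (v : L) :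
    fderiv ℝ (fun q : E × (Fin w.length → ℝ) => endpoint H (timed w q.2) q.1) (p, t) (X v p, 0) =
      X (transport a (timed w t) v) (endpoint H (timed w t) p) := by
  induction w generalizing p v with
  | nil =>
    have h1 : fderiv ℝ (fun q : E × (Fin ([] : List ι).length → ℝ) =>
        endpoint H (timed [] q.2) q.1) (p, t) = ContinuousLinearMap.fst ℝ E _ := fderiv_fst
    rw [h1]
    rfl
  | cons i w ih =>
    rw [fderiv_endpoint_cons hH]
    change fderiv ℝ _ _ (fderiv ℝ (H i) (t 0, p) (0, X v p), 0) = _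
    rw [fderiv_flow_apply hX (ha i) (hH i) (h0 i) (hflow i), ih]
    rfl

/-- Varying one time moves the point along its own field, and the remaining flows carry this
direction to the endpoint as `transport` prescribes. Linearity then gives every vector in the span.
-/
theorem exists_fderiv_endpoint_eq
    (hX : ∀ v, ContDiff ℝ 1 (X v))
    (ha : ∀ i v p, VectorField.lieBracket ℝ (X (x i)) (X v) p = X (a i v) p)
    (hH : ∀ i, ContDiff ℝ 2 (H i)) (h0 : ∀ i p, H i (0, p) = p)
    (hflow : ∀ i t p, HasDerivAt (fun s => H i (s, p)) (X (x i) (H i (t, p))) t)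
    (w : List ι) (p : E) (t : Fin w.length → ℝ) {v : L}
    (hv : v ∈ reach x a (timed w t)) :
    ∃ τ, fderiv ℝ (fun q : E × (Fin w.length → ℝ) => endpoint H (timed w q.2) q.1) (p, t) (0, τ) =
      X v (endpoint H (timed w t) p) := by
  induction w generalizing p v with
  | nil =>
    have : v = 0 := (Submodule.mem_bot ℝ).1 hv
    refine ⟨0, ?_⟩
    rw [this, map_zero, ← Prod.zero_eq_mk, map_zero]
    rfl
  | cons i w ih =>
    obtain ⟨v₁, hv₁, v₂, hv₂, rfl⟩ := Submodule.mem_sup.1 hv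
    obtain ⟨c, rfl⟩ := Submodule.mem_span_singleton.1 hv₁
    obtain ⟨τ, hτ⟩ := ih (H i (t 0, p)) (Fin.tail t) hv₂
    refine ⟨(Fin.cons c τ : Fin (w.length + 1) → ℝ), ?_⟩
    rw [fderiv_endpoint_cons hH]
    have h1 : fderiv ℝ (H i) (t 0, p) (c, 0) = c • X (x i) (H i (t 0, p)) := by
      have h2 := (((hH i).differentiable (by norm_num)) (t 0, p)).hasFDerivAt.comp_hasDerivAt (t 0)
        ((hasDerivAt_id (t 0)).prodMk (hasDerivAt_const (t 0) p))
      have h3 := h2.unique (hflow i (t 0) p)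
      have h4 : ((c, 0) : ℝ × E) = c • ((1 : ℝ), (0 : E)) := by simp
      rw [h4, map_smul, h3]
    rw [Fin.tail_cons, Fin.cons_zero, h1]
    have h5 : ((c • X (x i) (H i (t 0, p)), τ) : E × (Fin w.length → ℝ)) =
        c • (X (x i) (H i (t 0, p)), 0) + (0, τ) := by simp
    rw [h5, map_add, map_smul, hτ, fderiv_endpoint_frame hX ha hH h0 hflow, map_add, map_smul]
    rfl

/-- For almost all times along a word that repeats all letters as often as the dimension says, the
endpoint avoids a given null set. -/
theorem eventually_endpoint_notMem [FiniteDimensional ℝ E] [MeasurableSpace E] [BorelSpace E]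
    (hX : ∀ v, ContDiff ℝ 1 (X v))
    (ha : ∀ i v p, VectorField.lieBracket ℝ (X (x i)) (X v) p = X (a i v) p)
    (hH : ∀ i, ContDiff ℝ 2 (H i)) (h0 : ∀ i p, H i (0, p) = p)
    (hflow : ∀ i t p, HasDerivAt (fun s => H i (s, p)) (X (x i) (H i (t, p))) t)
    (ν : Measure E) [ν.IsAddHaarMeasure] {A : Set E} (hA : MeasurableSet A) (hA0 : ν A = 0)
    (hsurj : ∀ p u, ∃ v, X v p = u) {w : List ι} (hw : ∀ i, i ∈ w)
    (hgen : ∀ F : Submodule ℝ L, (∀ i, x i ∈ F) → (∀ i, ∀ v ∈ F, a i v ∈ F) → F = ⊤) (p : E) :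
    ∀ᶠ l in timesFilter (List.replicate (Module.finrank ℝ L) w).flatten, endpoint H l p ∉ A := by
  set W := (List.replicate (Module.finrank ℝ L) w).flatten with hW
  have hF := contDiff_endpoint_timed hH W
  let f : (Fin W.length → ℝ) → E := fun t => endpoint H (timed W t) p
  have hf : ContDiff ℝ 1 f := by
    have : ContDiff ℝ 2 f := hF.comp (contDiff_prodMk_right p)
    exact this.of_le (by norm_num)
  have hfd : ∀ t τ, fderiv ℝ f t τ = fderiv ℝ (fun q : E × (Fin W.length → ℝ) =>
      endpoint H (timed W q.2) q.1) (p, t) (0, τ) := by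
    intro t τ
    have h1 := ((hF.differentiable (by norm_num)) (p, t)).hasFDerivAt.comp t
      (hasFDerivAt_prodMk_right p t)
    exact DFunLike.congr_fun h1.fderiv τ
  have hnull := measure_submersion_preimage_eq_zero volume ν hf hA hA0
  have h1 : ∀ᵐ t, ¬ (reach x a (timed W t) = ⊤ ∧ endpoint H (timed W t) p ∈ A) := by
    filter_upwards [measure_eq_zero_iff_ae_notMem.1 hnull] with t ht h
    refine ht ⟨fun u => ?_, h.2⟩
    obtain ⟨v, hv⟩ := hsurj (f t) u
    obtain ⟨τ, hτ⟩ := exists_fderiv_endpoint_eq hX ha hH h0 hflow W p t (v := v)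
      (by rw [h.1]; trivial)
    exact ⟨τ, by rw [hfd, hτ]; exact hv⟩
  filter_upwards [eventually_timesFilter_of_ae W
    (P := fun l => ¬ (reach x a l = ⊤ ∧ endpoint H l p ∈ A)) h1, eventually_reach_eq_top hw hgen]
    with l hl hl'
  exact fun h => hl ⟨hl', h⟩

end EndpointDerivative
end NullDecomposition

namespace NullDecomposition

open Filter

/-! ### Positive parts and flow lines. -/

section PositivePart

variable {E : Type*} [NormedAddCommGroup E] [NormedSpace ℝ E]

theorem positivePart_subset (X : E → E) (A : Set E) : positivePart X A ⊆ A := fun _ h => h.1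

/-- No flow line spends positive time in the points of `B` whose flow line spends no time in `B`. -/
theorem lineMeasure_diff_positivePart (X : E → E) (B : Set E) (p : E) :
    lineMeasure X (B \ positivePart X B) p = 0 := by
  refine ENNReal.iSup_eq_zero.2 ?_
  rintro ⟨γ, hγ, -⟩
  by_contra hne
  obtain ⟨t₀, ht₀, hpos⟩ := nonempty_of_measure_ne_zero hne
  have h1 : lineMeasure X B (γ t₀) = 0 := by
    by_contra h
    exact hpos ⟨ht₀, pos_iff_ne_zero.2 h⟩
  -- The curve restarted at `γ t₀` is the same flow line with shifted time, and Lebesgue measure is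
  -- translation invariant.
  have h2 := ENNReal.iSup_eq_zero.1 h1
    ⟨fun t => γ (t + t₀), hγ.comp_add t₀, by simp⟩
  have h3 : volume (γ ⁻¹' B) = 0 := by
    rw [← measure_preimage_add_right volume t₀ (γ ⁻¹' B)]
    exact h2
  exact hne (measure_mono_null (Set.preimage_mono Set.sdiff_subset) h3)

theorem lineMeasure_biUnion_eq_zero {κ : Type*} (X : E → E) (s : Finset κ) (S : κ → Set E) (p : E)
    (h : ∀ k ∈ s, lineMeasure X (S k) p = 0) : lineMeasure X (⋃ k ∈ s, S k) p = 0 := by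
  refine ENNReal.iSup_eq_zero.2 fun γ => ?_
  rw [Set.preimage_iUnion₂]
  exact (measure_biUnion_null_iff s.countable_toSet).2
    fun k hk => ENNReal.iSup_eq_zero.1 (h k hk) γ

theorem lineMeasure_eq_of_flow {X : E → E} {H : ℝ × E → E} (h0 : ∀ p, H (0, p) = p)
    (hflow : ∀ t p, HasDerivAt (fun s => H (s, p)) (X (H (t, p))) t)
    (huniq : ∀ γ : ℝ → E, IsIntegralCurve γ (fun _ => X) → ∀ t, γ t = H (t, γ 0))
    (S : Set E) (p : E) : lineMeasure X S p = volume {t | H (t, p) ∈ S} := by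
  refine le_antisymm (iSup_le ?_) ?_
  · rintro ⟨γ, hγ, rfl⟩
    refine measure_mono fun t ht => ?_
    have : γ t ∈ S := ht
    rwa [huniq γ hγ t] at this
  · exact le_iSup (fun γ : {γ : ℝ → E // IsIntegralCurve γ (fun _ => X) ∧ γ 0 = p} =>
      volume (γ.1 ⁻¹' S)) ⟨fun t => H (t, p), fun t => hflow t p, h0 p⟩

theorem measurableSet_positivePart [MeasurableSpace E] [BorelSpace E]
    [SecondCountableTopology E] {X : E → E} {H : ℝ × E → E} (hH : Continuous H)
    (hline : ∀ S p, lineMeasure X S p = volume {t | H (t, p) ∈ S})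
    {A : Set E} (hA : MeasurableSet A) : MeasurableSet (positivePart X A) := by
  have h1 : MeasurableSet (H ⁻¹' A) := hH.measurable hA
  have h2 : Measurable fun p => volume {t | H (t, p) ∈ A} :=
    measurable_measure_prodMk_right h1
  refine hA.inter (?_ : MeasurableSet {p | 0 < lineMeasure X A p})
  simp only [hline]
  exact measurableSet_lt measurable_const h2

end PositivePart

/-! ### The chain of word parts and its differences. -/

section WordPart

variable {E : Type*} [NormedAddCommGroup E] [NormedSpace ℝ E] {n : ℕ} {X : Fin n → E → E}

theorem wordPart_append (A : Set E) (u w : List (Fin n)) :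
    wordPart X A (u ++ w) = wordPart X (wordPart X A u) w := List.foldl_append

theorem wordPart_concat (A : Set E) (w : List (Fin n)) (i : Fin n) :
    wordPart X A (w ++ [i]) = positivePart (X i) (wordPart X A w) := wordPart_append A w [i]

theorem wordPart_subset (A : Set E) (w : List (Fin n)) : wordPart X A w ⊆ A := by
  induction w using List.reverseRecOn with
  | nil => exact subset_rfl
  | append_singleton w i ih =>
    rw [wordPart_concat]
    exact (positivePart_subset _ _).trans ih

theorem wordPart_subset_of_isPrefix (A : Set E) {u w : List (Fin n)} (h : u <+: w) :
    wordPart X A w ⊆ wordPart X A u := by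
  obtain ⟨v, rfl⟩ := h
  rw [wordPart_append]
  exact wordPart_subset _ _

theorem fullWord_succ (n k : ℕ) : fullWord n (k + 1) = fullWord n k ++ List.finRange n := by
  simp [fullWord, List.replicate_add]

theorem fullWord_isPrefix {k j : ℕ} (h : k ≤ j) : fullWord n k <+: fullWord n j := by
  obtain ⟨d, rfl⟩ := Nat.exists_eq_add_of_le h
  rw [fullWord, fullWord, List.replicate_add, List.flatten_append]
  exact List.prefix_append _ _

theorem take_succ_finRange (i : Fin n) :
    (List.finRange n).take ((i : ℕ) + 1) = (List.finRange n).take i ++ [i] := by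
  rw [List.take_succ_eq_append_getElem (by simp)]
  simp

theorem wordPart_take_succ (A : Set E) (k : ℕ) (i : Fin n) :
    wordPart X A (fullWord n k ++ (List.finRange n).take ((i : ℕ) + 1)) =
      positivePart (X i) (wordPart X A (fullWord n k ++ (List.finRange n).take i)) := by
  rw [take_succ_finRange, ← List.append_assoc, wordPart_concat]

/-- Word parts decrease along prefixes, so a point removed at one stage is absent from all later
ones. -/
theorem pairwise_disjoint_piece (m : ℕ) (A : Set E) :
    Pairwise (Function.onFun Disjoint (piece m X A)) := by
  have key : ∀ (k k' : ℕ) (i j : Fin n), k < k' ∨ (k = k' ∧ i < j) → ∀ p,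
      p ∉ wordPart X A (fullWord n k ++ (List.finRange n).take ((i : ℕ) + 1)) →
      p ∉ wordPart X A (fullWord n k' ++ (List.finRange n).take j) := by
    intro k k' i j h p hp hp'
    refine hp (wordPart_subset_of_isPrefix A ?_ hp')
    rcases h with h | ⟨rfl, h⟩
    · have h1 : fullWord n k ++ (List.finRange n).take ((i : ℕ) + 1) <+: fullWord n (k + 1) := by
        rw [fullWord_succ]
        exact (List.prefix_append_right_inj _).2 (List.take_prefix _ _)
      exact h1.trans ((fullWord_isPrefix h).trans (List.prefix_append _ _))
    · exact (List.prefix_append_right_inj _).2 (List.take_prefix_take_left h)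
  intro i j hij
  refine Set.disjoint_left.2 fun p hi hj => ?_
  simp only [piece, Set.mem_iUnion, Finset.mem_range] at hi hj
  obtain ⟨k, -, hk, hk'⟩ := hi
  obtain ⟨l, -, hl, hl'⟩ := hj
  rcases lt_trichotomy k l with h | h | h
  · exact key k l i j (Or.inl h) p hk' hl
  · rcases lt_or_gt_of_ne hij with h' | h'
    · exact key k l i j (Or.inr ⟨h, h'⟩) p hk' hl
    · exact key l k j i (Or.inr ⟨h.symm, h'⟩) p hl' hk
  · exact key l k j i (Or.inl h) p hl' hk

theorem eq_iUnion_piece {m : ℕ} {A : Set E} (h : wordPart X A (fullWord n m) = ∅) :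
    A = ⋃ i, piece m X A i := by
  refine Set.Subset.antisymm (fun p hp => ?_) (Set.iUnion_subset fun i => ?_)
  · by_contra hcon
    simp only [piece, Set.mem_iUnion, Finset.mem_range, not_exists] at hcon
    have hstep : ∀ k < m, p ∈ wordPart X A (fullWord n k) →
        ∀ i ≤ n, p ∈ wordPart X A (fullWord n k ++ (List.finRange n).take i) := by
      intro k hk hpk i
      induction i with
      | zero => intro; simpa using hpk
      | succ i ih =>
        intro hi
        by_contra hne
        exact hcon ⟨i, hi⟩ k hk ⟨ih (by omega), hne⟩
    have hall : ∀ k ≤ m, p ∈ wordPart X A (fullWord n k) := by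
      intro k
      induction k with
      | zero => intro; exact hp
      | succ k ih =>
        intro hk
        have := hstep k hk (ih (by omega)) n le_rfl
        rwa [List.take_of_length_le (by simp), ← fullWord_succ] at this
    have := hall m le_rfl
    rw [h] at this
    exact this
  · refine Set.iUnion₂_subset fun k _ => ?_
    exact Set.sdiff_subset.trans (wordPart_subset _ _)

theorem lineMeasure_piece (m : ℕ) (A : Set E) (i : Fin n) (p : E) :
    lineMeasure (X i) (piece m X A i) p = 0 := by
  refine lineMeasure_biUnion_eq_zero _ _ _ _ fun k _ => ?_
  rw [wordPart_take_succ]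
  exact lineMeasure_diff_positivePart _ _ _

theorem measurableSet_piece [MeasurableSpace E]
    (hX : ∀ i A, MeasurableSet A → MeasurableSet (positivePart (X i) A)) (m : ℕ) {A : Set E}
    (hA : MeasurableSet A) (i : Fin n) : MeasurableSet (piece m X A i) := by
  have hw : ∀ w, MeasurableSet (wordPart X A w) := by
    intro w
    induction w using List.reverseRecOn with
    | nil => exact hA
    | append_singleton w i ih => rw [wordPart_concat]; exact hX _ _ ih
  exact Finset.measurableSet_biUnion _ fun k _ => (hw _).diff (hw _)

/-- The last letter of the word is the outermost operation, hence the first flow out of `p`; this is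
why the word is reversed. Iterated quantifiers match this recursion letter by letter. -/
theorem notMem_wordPart_of_eventually {H : Fin n → ℝ × E → E}
    (hline : ∀ i S p, lineMeasure (X i) S p = volume {t | H i (t, p) ∈ S}) {A : Set E}
    (w : List (Fin n)) {p : E} (h : ∀ᶠ l in timesFilter w.reverse, endpoint H l p ∉ A) :
    p ∉ wordPart X A w := by
  induction w using List.reverseRecOn generalizing p with
  | nil => exact eventually_timesFilter_nil.1 h
  | append_singleton w i ih =>
    rw [List.reverse_append, List.reverse_singleton, List.singleton_append,
      eventually_timesFilter_cons] at h
    rw [wordPart_concat]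
    rintro ⟨-, hpos⟩
    rw [hline] at hpos
    refine hpos.ne' (measure_eq_zero_iff_ae_notMem.2 ?_)
    filter_upwards [h] with t ht
    exact ih ht

theorem reverse_fullWord (n m : ℕ) :
    (fullWord n m).reverse = (List.replicate m (List.finRange n).reverse).flatten := by
  rw [fullWord, List.reverse_flatten, List.map_replicate, List.reverse_replicate]

end WordPart
end NullDecomposition

namespace NullDecomposition

open Filter VectorField

/-! ### Left-invariant fields and their completeness. -/

section LieGroup

theorem comp_smulRight_one {E F : Type*} [NormedAddCommGroup E] [NormedSpace ℝ E]
    [NormedAddCommGroup F] [NormedSpace ℝ F] (A : E →L[ℝ] F) (v : E) :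
    A.comp ((1 : ℝ →L[ℝ] ℝ).smulRight v) = (1 : ℝ →L[ℝ] ℝ).smulRight (A v) := by
  ext; simp

variable {m : ℕ} {G : Type*} [TopologicalSpace G] [ChartedSpace (EuclideanSpace ℝ (Fin m)) G]
  [Group G] [LieGroup (𝓡 m) ∞ G]

theorem mdifferentiableAt_mul_left (h g : G) :
    MDifferentiableAt (𝓡 m) (𝓡 m) (fun y : G => h * y) g :=
  (contMDiff_mul_left (I := 𝓡 m) (n := ∞)).contMDiffAt.mdifferentiableAt (by simp)

theorem mfderiv_mul_left_mulInvariantVectorField (h g : G) (v : GroupLieAlgebra (𝓡 m) G) :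
    mfderiv (𝓡 m) (𝓡 m) (fun y : G => h * y) g (mulInvariantVectorField v g) =
      mulInvariantVectorField v (h * g) := by
  -- The chain rule needs the base point `g * 1` rather than `g`; typing the derivative on the model
  -- space avoids a dependent rewrite.
  have key : ∀ g' : G, g' = g → HasMFDerivAt (𝓡 m) (𝓡 m) (fun y : G => h * y) g'
      (mfderiv (𝓡 m) (𝓡 m) (fun y : G => h * y) g :
        EuclideanSpace ℝ (Fin m) →L[ℝ] EuclideanSpace ℝ (Fin m)) := by
    rintro _ rfl
    exact (mdifferentiableAt_mul_left h _).hasMFDerivAt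
  have h1 := (key (g * 1) (mul_one g)).comp 1 (mdifferentiableAt_mul_left g 1).hasMFDerivAt
  have h2 : (fun y : G => h * y) ∘ (fun y => g * y) = fun y => h * g * y := by
    ext y; simp [mul_assoc]
  rw [h2] at h1
  exact (DFunLike.congr_fun h1.mfderiv v).symm

/-- Left translates of integral curves of left-invariant vector fields are integral curves. -/
theorem isMIntegralCurveOn_mul_left {v : GroupLieAlgebra (𝓡 m) G} {γ : ℝ → G} {s : Set ℝ}
    (hγ : IsMIntegralCurveOn γ (mulInvariantVectorField v) s) (h : G) :
    IsMIntegralCurveOn (fun t => h * γ t) (mulInvariantVectorField v) s := by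
  intro t ht
  have h1 : HasMFDerivAt (𝓡 m) (𝓡 m) (fun y : G => h * y) (γ t) _ :=
    (mdifferentiableAt_mul_left h _).hasMFDerivAt
  have h2 := h1.comp_hasMFDerivWithinAt t (hγ t ht)
  have h3 := comp_smulRight_one (E := EuclideanSpace ℝ (Fin m)) (F := EuclideanSpace ℝ (Fin m))
    (mfderiv (𝓡 m) (𝓡 m) (fun y : G => h * y) (γ t)) (mulInvariantVectorField v (γ t))
  rw [← mfderiv_mul_left_mulInvariantVectorField]
  exact h3 ▸ h2

theorem isMIntegralCurve_mul_left {v : GroupLieAlgebra (𝓡 m) G} {γ : ℝ → G}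
    (hγ : IsMIntegralCurve γ (mulInvariantVectorField v)) (h : G) :
    IsMIntegralCurve (fun t => h * γ t) (mulInvariantVectorField v) :=
  isMIntegralCurve_iff_isMIntegralCurveOn.2
    (isMIntegralCurveOn_mul_left (isMIntegralCurve_iff_isMIntegralCurveOn.1 hγ) h)

theorem contMDiff_one_mulInvariantVectorField (v : GroupLieAlgebra (𝓡 m) G) :
    ContMDiff (𝓡 m) (𝓡 m).tangent 1
      (fun g : G => (⟨g, mulInvariantVectorField v g⟩ : TangentBundle (𝓡 m) G)) :=
  (contMDiff_mulInvariantVectorField v).of_le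
    (by rw [minSmoothness_of_isRCLikeNormedField]; norm_num)

/-- Left-invariant vector fields are complete. -/
theorem exists_isMIntegralCurve_mulInvariantVectorField [T2Space G]
    (v : GroupLieAlgebra (𝓡 m) G) :
    ∃ γ : ℝ → G, γ 0 = 1 ∧ IsMIntegralCurve γ (mulInvariantVectorField v) := by
  have : IsManifold (𝓡 m) 1 G := IsManifold.of_le (n := ∞) (by simp)
  have hv := contMDiff_one_mulInvariantVectorField v
  obtain ⟨γ, h0, hγ⟩ := exists_isMIntegralCurveAt_of_contMDiffAt_boundaryless
    (t₀ := 0) (x₀ := (1 : G)) hv.contMDiffAt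
  obtain ⟨ε, hε, hγ⟩ := isMIntegralCurveAt_iff'.1 hγ
  -- Left translation gives the same existence time `ε` at every point, which rules out blow-up.
  refine exists_isMIntegralCurve_of_isMIntegralCurveOn hv hε (fun g => ?_) 1
  refine ⟨fun t => g * γ t, by simp [h0], ?_⟩
  rw [Real.ball_eq_Ioo, zero_sub, zero_add] at hγ
  exact isMIntegralCurveOn_mul_left hγ g

end LieGroup

/-! ### Derivatives of the identification with Euclidean space. -/

section Diffeomorphism

variable {m : ℕ} {G : Type*} [TopologicalSpace G] [ChartedSpace (EuclideanSpace ℝ (Fin m)) G]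
  (φ : G ≃ₘ⟮𝓡 m, 𝓡 m⟯ EuclideanSpace ℝ (Fin m))

theorem mdifferentiableAt_diffeomorph (g : G) : MDifferentiableAt (𝓡 m) (𝓡 m) φ g :=
  φ.contMDiffAt.mdifferentiableAt (by simp)

theorem mdifferentiableAt_diffeomorph_symm (p : EuclideanSpace ℝ (Fin m)) :
    MDifferentiableAt (𝓡 m) (𝓡 m) φ.symm p :=
  φ.symm.contMDiffAt.mdifferentiableAt (by simp)

theorem mfderiv_diffeomorph_comp_symm (p : EuclideanSpace ℝ (Fin m)) :
    (mfderiv (𝓡 m) (𝓡 m) φ (φ.symm p)).comp (mfderiv (𝓡 m) (𝓡 m) φ.symm p) = .id ℝ _ := by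
  rw [← mfderiv_comp p (mdifferentiableAt_diffeomorph φ _) (mdifferentiableAt_diffeomorph_symm φ p)]
  have : φ ∘ φ.symm = id := by ext1 q; simp
  rw [this, mfderiv_id]

theorem mfderiv_diffeomorph_symm_comp (p : EuclideanSpace ℝ (Fin m)) :
    (mfderiv (𝓡 m) (𝓡 m) φ.symm p).comp (mfderiv (𝓡 m) (𝓡 m) φ (φ.symm p)) = .id ℝ _ := by
  have key : ∀ q, q = p → HasMFDerivAt (𝓡 m) (𝓡 m) φ.symm q
      (mfderiv (𝓡 m) (𝓡 m) φ.symm p :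
        EuclideanSpace ℝ (Fin m) →L[ℝ] EuclideanSpace ℝ (Fin m)) := by
    rintro _ rfl
    exact (mdifferentiableAt_diffeomorph_symm φ _).hasMFDerivAt
  have h2 := (key _ (φ.apply_symm_apply p)).comp (φ.symm p)
    (mdifferentiableAt_diffeomorph φ (φ.symm p)).hasMFDerivAt
  have h3 : φ.symm ∘ φ = id := by ext1 q; simp
  rw [h3] at h2
  exact hasMFDerivAt_unique h2 (hasMFDerivAt_id _)

theorem isInvertible_mfderiv_diffeomorph_symm (p : EuclideanSpace ℝ (Fin m)) :
    (mfderiv (𝓡 m) (𝓡 m) φ.symm p).IsInvertible :=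
  ContinuousLinearMap.IsInvertible.of_inverse (mfderiv_diffeomorph_symm_comp φ p)
    (mfderiv_diffeomorph_comp_symm φ p)

end Diffeomorphism

/-! ### The left-invariant frame in coordinates. -/

section CoordField

theorem mlieBracket_apply_eq_lieBracket {E : Type*} [NormedAddCommGroup E] [NormedSpace ℝ E]
    (V W : (p : E) → TangentSpace 𝓘(ℝ, E) p) (p : E) :
    mlieBracket 𝓘(ℝ, E) V W p = lieBracket ℝ V W p := by
  rw [← mlieBracketWithin_univ, mlieBracketWithin_eq_lieBracketWithin]
  exact congrFun lieBracketWithin_univ p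

variable {m : ℕ} {G : Type*} [TopologicalSpace G] [ChartedSpace (EuclideanSpace ℝ (Fin m)) G]
  [Group G] [LieGroup (𝓡 m) ∞ G] (φ : G ≃ₘ⟮𝓡 m, 𝓡 m⟯ EuclideanSpace ℝ (Fin m))

theorem coordField_eq_mpullback (v : GroupLieAlgebra (𝓡 m) G) :
    coordField φ v = mpullback (𝓡 m) (𝓡 m) φ.symm (mulInvariantVectorField v) := by
  ext1 p
  rw [mpullback_apply, ContinuousLinearMap.inverse_eq (mfderiv_diffeomorph_symm_comp φ p)
    (mfderiv_diffeomorph_comp_symm φ p)]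
  rfl

theorem contDiff_coordField (v : GroupLieAlgebra (𝓡 m) G) : ContDiff ℝ 1 (coordField φ v) := by
  have : IsManifold (𝓡 m) 1 G := IsManifold.of_le (n := ∞) (by simp)
  have : IsManifold (𝓡 m) 2 G := IsManifold.of_le (n := ∞) ENat.LEInfty.out
  refine contMDiff_vectorSpace_iff_contDiff.1 ?_
  rw [coordField_eq_mpullback]
  exact (contMDiff_one_mulInvariantVectorField v).mpullback_vectorField
    (n := 2) (φ.symm.contMDiff.of_le ENat.LEInfty.out) (isInvertible_mfderiv_diffeomorph_symm φ)
    (by norm_num)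

/-- Pullback along `φ.symm` commutes with brackets, and left-invariant fields are closed under them.
This makes the adjoint action govern the flows in coordinates. -/
theorem lieBracket_coordField (v w : GroupLieAlgebra (𝓡 m) G) :
    lieBracket ℝ (coordField φ v) (coordField φ w) = coordField φ ⁅v, w⁆ := by
  ext1 p
  refine (mlieBracket_apply_eq_lieBracket (coordField φ v) (coordField φ w) p).symm.trans ?_
  rw [coordField_eq_mpullback, coordField_eq_mpullback,
    coordField_eq_mpullback, GroupLieAlgebra.bracket_def, mulInvariantVector_mlieBracket]
  refine (mpullback_mlieBracket (n := ∞) (mdifferentiableAt_mulInvariantVectorField v)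
    (mdifferentiableAt_mulInvariantVectorField w) φ.symm.contMDiffAt ?_).symm
  rw [minSmoothness_of_isRCLikeNormedField]
  exact ENat.LEInfty.out

/-- The coordinate expressions of the left-invariant vector fields. -/
noncomputable def coordFrame :
    GroupLieAlgebra (𝓡 m) G →ₗ[ℝ] EuclideanSpace ℝ (Fin m) → EuclideanSpace ℝ (Fin m) where
  toFun := coordField φ
  map_add' v w := by
    ext1 p
    simp only [coordField, mulInvariantVectorField_add, Pi.add_apply]
    exact map_add _ _ _
  map_smul' c v := by
    ext1 p
    simp only [coordField, mulInvariantVectorField_smul, Pi.smul_apply]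
    exact map_smul _ _ _

theorem coordField_surjective (p u : EuclideanSpace ℝ (Fin m)) : ∃ v, coordField φ v p = u := by
  set g := φ.symm p with hg
  obtain ⟨u', hu'⟩ : ∃ u' : EuclideanSpace ℝ (Fin m), mfderiv (𝓡 m) (𝓡 m) φ g u' = u :=
    ⟨_, DFunLike.congr_fun (mfderiv_diffeomorph_comp_symm φ p) u⟩
  have h1 : HasMFDerivAt (𝓡 m) (𝓡 m) (fun y : G => g * y) (g⁻¹ * g)
      (mfderiv (𝓡 m) (𝓡 m) (fun y : G => g * y) 1 :
        EuclideanSpace ℝ (Fin m) →L[ℝ] EuclideanSpace ℝ (Fin m)) := by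
    rw [inv_mul_cancel]
    exact (mdifferentiableAt_mul_left g 1).hasMFDerivAt
  have h2 := h1.comp g (mdifferentiableAt_mul_left g⁻¹ g).hasMFDerivAt
  have h3 : (fun y : G => g * y) ∘ (fun y => g⁻¹ * y) = id := by ext y; simp
  rw [h3] at h2
  have h4 := DFunLike.congr_fun (hasMFDerivAt_unique h2 (hasMFDerivAt_id g)) u'
  exact ⟨_, (congrArg (mfderiv (𝓡 m) (𝓡 m) φ g) h4).trans hu'⟩

theorem hasDerivAt_diffeomorph_comp {v : GroupLieAlgebra (𝓡 m) G} {γ : ℝ → G}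
    (hγ : IsMIntegralCurve γ (mulInvariantVectorField v)) (t : ℝ) :
    HasDerivAt (fun s => φ (γ s)) (coordField φ v (φ (γ t))) t := by
  have h1 := (mdifferentiableAt_diffeomorph φ (γ t)).hasMFDerivAt.comp t (hγ t)
  have h0 := comp_smulRight_one (E := EuclideanSpace ℝ (Fin m)) (F := EuclideanSpace ℝ (Fin m))
    (mfderiv (𝓡 m) (𝓡 m) φ (γ t)) (mulInvariantVectorField v (γ t))
  have h2 : HasDerivAt (fun s => φ (γ s)) (mfderiv (𝓡 m) (𝓡 m) φ (γ t)
      (mulInvariantVectorField v (γ t)) : EuclideanSpace ℝ (Fin m)) t :=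
    (h0 ▸ h1).hasFDerivAt
  have h3 : φ.symm (φ (γ t)) = γ t := φ.symm_apply_apply _
  unfold coordField
  rw [h3]
  exact h2

end CoordField
end NullDecomposition

/-- A subspace that contains a basis of the first layer of a stratification and is invariant under
the adjoint action of this basis is the whole Lie algebra. -/
theorem LieStratification.eq_top_of_basis_mem {L κ : Type*} [LieRing L] [LieAlgebra ℝ L]
    (V : LieStratification L) (b : Module.Basis κ ℝ (V.layer 1)) (F : Submodule ℝ L)
    (hb : ∀ i, (b i : L) ∈ F) (hF : ∀ i, ∀ v ∈ F, ⁅(b i : L), v⁆ ∈ F) : F = ⊤ := by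
  have hspan : ∀ y ∈ V.layer 1, y ∈ Submodule.span ℝ (Set.range fun i => (b i : L)) := by
    intro y hy
    have h1 : Submodule.map (V.layer 1).subtype (Submodule.span ℝ (Set.range b)) =
        Submodule.span ℝ (Set.range fun i => (b i : L)) := by
      rw [Submodule.map_span, ← Set.range_comp]
      rfl
    rw [← h1, b.span_eq]
    exact ⟨⟨y, hy⟩, trivial, rfl⟩
  have hone : V.layer 1 ≤ F := by
    intro y hy
    refine Submodule.span_le.2 ?_ (hspan y hy)
    rintro _ ⟨i, rfl⟩
    exact hb i
  have hbr : ∀ y ∈ V.layer 1, ∀ v ∈ F, ⁅y, v⁆ ∈ F := by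
    intro y hy v hv
    refine Submodule.span_induction (p := fun y _ => ⁅y, v⁆ ∈ F) ?_ ?_ ?_ ?_ (hspan y hy)
    · rintro _ ⟨i, rfl⟩
      exact hF i v hv
    · simp
    · intro y z _ _ h1 h2
      rw [add_lie]
      exact F.add_mem h1 h2
    · intro c y _ h1
      rw [smul_lie]
      exact F.smul_mem c h1
  have hlayer : ∀ j, V.layer (j + 1) ≤ F := by
    intro j
    induction j with
    | zero => exact hone
    | succ j ih =>
      by_cases hj : j + 1 ≤ V.step
      · rw [← V.span_bracket (j + 1) (by omega) hj]
        refine Submodule.span_le.2 ?_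
        rintro _ ⟨y, hy, v, hv, rfl⟩
        exact hbr y hy v (ih hv)
      · rw [V.layer_eq_bot _ (Or.inr (by omega))]
        exact bot_le
  rw [eq_top_iff, ← V.isInternal.submodule_iSup_eq_top]
  refine iSup_le fun j => ?_
  cases j with
  | zero => rw [V.layer_eq_bot 0 (Or.inl rfl)]; exact bot_le
  | succ j => exact hlayer j

namespace NullDecomposition

open Filter

/-! ### Flows of left-invariant fields in coordinates. -/

section Flow

/-- Uniqueness of integral curves of a `C¹` vector field on a vector space. -/
theorem isIntegralCurve_unique {E : Type*} [NormedAddCommGroup E] [NormedSpace ℝ E]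
    [CompleteSpace E] {X : E → E} (hX : ContDiff ℝ 1 X) {γ γ' : ℝ → E}
    (hγ : IsIntegralCurve γ fun _ => X) (hγ' : IsIntegralCurve γ' fun _ => X) (h : γ 0 = γ' 0) :
    γ = γ' := by
  refine isMIntegralCurve_Ioo_eq_of_contMDiff_boundaryless (I := 𝓘(ℝ, E)) (v := X) (t₀ := 0)
    (contMDiff_vectorSpace_iff_contDiff.2 hX) (fun t => ?_) (fun t => ?_) h
  · exact (hγ t).hasFDerivAt.hasMFDerivAt
  · exact (hγ' t).hasFDerivAt.hasMFDerivAt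

variable {m : ℕ} {G : Type*} [TopologicalSpace G] [ChartedSpace (EuclideanSpace ℝ (Fin m)) G]
  [Group G] (φ : G ≃ₘ⟮𝓡 m, 𝓡 m⟯ EuclideanSpace ℝ (Fin m))

/-- The flow, in coordinates, of a left-invariant vector field with the integral curve `γ` through
the identity. -/
noncomputable def coordFlow (γ : ℝ → G) (q : ℝ × EuclideanSpace ℝ (Fin m)) :
    EuclideanSpace ℝ (Fin m) :=
  φ (φ.symm q.2 * γ q.1)

theorem coordFlow_zero {γ : ℝ → G} (hγ0 : γ 0 = 1) (p : EuclideanSpace ℝ (Fin m)) :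
    coordFlow φ γ (0, p) = p := by
  simp [coordFlow, hγ0]

variable [LieGroup (𝓡 m) ∞ G] {v : GroupLieAlgebra (𝓡 m) G} {γ : ℝ → G}

theorem hasDerivAt_coordFlow (hγ : IsMIntegralCurve γ (mulInvariantVectorField v)) (t : ℝ)
    (p : EuclideanSpace ℝ (Fin m)) :
    HasDerivAt (fun s => coordFlow φ γ (s, p)) (coordField φ v (coordFlow φ γ (t, p))) t :=
  hasDerivAt_diffeomorph_comp φ (isMIntegralCurve_mul_left hγ (φ.symm p)) t

/-- The flow is right multiplication by `γ`, so its regularity comes from the group law and `γ`; an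
integral curve of a $C^1$ field is $C^2$ by bootstrapping. -/
theorem contDiff_coordFlow (hγ : IsMIntegralCurve γ (mulInvariantVectorField v)) :
    ContDiff ℝ 2 (coordFlow φ γ) := by
  have hd := hasDerivAt_diffeomorph_comp φ hγ
  have hcont : Continuous fun t => φ (γ t) :=
    continuous_iff_continuousAt.2 fun t => (hd t).continuousAt
  have hderiv : deriv (fun t => φ (γ t)) = fun t => coordField φ v (φ (γ t)) :=
    funext fun t => (hd t).deriv
  have hC1 : ContDiff ℝ 1 fun t => φ (γ t) := by
    rw [contDiff_one_iff_deriv, hderiv]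
    exact ⟨fun t => (hd t).differentiableAt, (contDiff_coordField φ v).continuous.comp hcont⟩
  have hC2 : ContDiff ℝ 2 fun t => φ (γ t) := by
    rw [show (2 : WithTop ℕ∞) = 1 + 1 by norm_num, contDiff_succ_iff_deriv, hderiv]
    exact ⟨fun t => (hd t).differentiableAt, by simp, (contDiff_coordField φ v).comp hC1⟩
  have h2 : (2 : WithTop ℕ∞) ≤ (∞ : WithTop ℕ∞) := ENat.LEInfty.out
  have hsymm : ContMDiff (𝓡 m) (𝓡 m) 2 φ.symm := φ.symm.contMDiff.of_le h2
  have hγ2 : ContMDiff 𝓘(ℝ, ℝ × EuclideanSpace ℝ (Fin m)) (𝓡 m) 2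
      fun q : ℝ × EuclideanSpace ℝ (Fin m) => γ q.1 := by
    have h3 := hsymm.comp (hC2.comp (contDiff_fst (E := ℝ)
      (F := EuclideanSpace ℝ (Fin m)))).contMDiff
    have h4 : (fun q : ℝ × EuclideanSpace ℝ (Fin m) => γ q.1) =
        φ.symm ∘ (fun t => φ (γ t)) ∘ Prod.fst := by
      funext q
      exact (φ.symm_apply_apply _).symm
    rwa [h4]
  have hp : ContMDiff 𝓘(ℝ, ℝ × EuclideanSpace ℝ (Fin m)) (𝓡 m) 2
      fun q : ℝ × EuclideanSpace ℝ (Fin m) => φ.symm q.2 :=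
    hsymm.comp (contDiff_snd (E := ℝ) (F := EuclideanSpace ℝ (Fin m))).contMDiff
  have : LieGroup (𝓡 m) 2 G := LieGroup.of_le h2
  exact ((φ.contMDiff.of_le h2).comp (hp.mul hγ2)).contDiff

end Flow
end NullDecomposition

open NullDecomposition

theorem proposition3p9 {m n : ℕ} {G : Type*} [TopologicalSpace G]
    [ChartedSpace (EuclideanSpace ℝ (Fin m)) G] [Group G] [LieGroup (𝓡 m) ∞ G]
    [SimplyConnectedSpace G]
    (V : LieStratification (GroupLieAlgebra (𝓡 m) G))
    (b : Module.Basis (Fin n) ℝ (V.layer 1))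
    (φ : G ≃ₘ⟮𝓡 m, 𝓡 m⟯ EuclideanSpace ℝ (Fin m))
    (X : Fin n → EuclideanSpace ℝ (Fin m) → EuclideanSpace ℝ (Fin m))
    (hX : ∀ i, X i = NullDecomposition.coordField φ (b i : GroupLieAlgebra (𝓡 m) G))
    (A : Set (EuclideanSpace ℝ (Fin m))) (hA : MeasurableSet A) (hA0 : volume A = 0) :
    (A = ⋃ i, NullDecomposition.piece m X A i) ∧
    Pairwise (Function.onFun Disjoint (NullDecomposition.piece m X A)) ∧
    (∀ i, MeasurableSet (NullDecomposition.piece m X A i)) ∧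
    ∀ i x, NullDecomposition.lineMeasure (X i) (NullDecomposition.piece m X A i) x = 0 := by
  have : T2Space G := φ.toHomeomorph.symm.t2Space
  choose γ hγ0 hγ using fun i => exists_isMIntegralCurve_mulInvariantVectorField
    (b i : GroupLieAlgebra (𝓡 m) G)
  let H : Fin n → ℝ × EuclideanSpace ℝ (Fin m) → EuclideanSpace ℝ (Fin m) :=
    fun i => coordFlow φ (γ i)
  have hH : ∀ i, ContDiff ℝ 2 (H i) := fun i => contDiff_coordFlow φ (hγ i)
  have h0 : ∀ i p, H i (0, p) = p := fun i p => coordFlow_zero φ (hγ0 i) p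
  have hflow : ∀ i t p, HasDerivAt (fun s => H i (s, p)) (coordField φ (b i) (H i (t, p))) t :=
    fun i t p => hasDerivAt_coordFlow φ (hγ i) t p
  have hline : ∀ i S p, lineMeasure (X i) S p = volume {t | H i (t, p) ∈ S} := by
    intro i S p
    rw [hX]
    refine lineMeasure_eq_of_flow (h0 i) (hflow i) (fun c hc t => ?_) S p
    exact congrFun (isIntegralCurve_unique (contDiff_coordField φ _) hc
      (fun t => hflow i t (c 0)) (h0 i _).symm) t
  -- The Lie algebra is viewed as its model space, whose Euclidean norm serves the operator
  -- exponentials and whose dimension is `m`.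
  let Λ : EuclideanSpace ℝ (Fin m) →ₗ[ℝ] EuclideanSpace ℝ (Fin m) → EuclideanSpace ℝ (Fin m) :=
    coordFrame φ
  let y : Fin n → EuclideanSpace ℝ (Fin m) := fun i => (b i : GroupLieAlgebra (𝓡 m) G)
  let ad : Fin n → EuclideanSpace ℝ (Fin m) →ₗ[ℝ] EuclideanSpace ℝ (Fin m) := fun i =>
    LieAlgebra.ad ℝ (GroupLieAlgebra (𝓡 m) G) (b i : GroupLieAlgebra (𝓡 m) G)
  have hempty : wordPart X A (fullWord n m) = ∅ := by
    refine Set.eq_empty_iff_forall_notMem.2 fun p => notMem_wordPart_of_eventually hline _ ?_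
    rw [reverse_fullWord]
    have key := eventually_endpoint_notMem (X := Λ) (x := y)
      (a := fun i => (ad i).toContinuousLinearMap) (H := H) (fun v => contDiff_coordField φ v)
      (fun i v p => congrFun (lieBracket_coordField φ (b i) v) p) hH h0 hflow volume hA hA0
      (coordField_surjective φ) (w := (List.finRange n).reverse) (by simp)
      (fun F hF1 hF2 => V.eq_top_of_basis_mem b F hF1 hF2) p
    rwa [finrank_euclideanSpace_fin] at key
  refine ⟨eq_iUnion_piece hempty, pairwise_disjoint_piece m A,
    measurableSet_piece (fun i B hB => ?_) m hA, lineMeasure_piece m A⟩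
  exact measurableSet_positivePart (hH i).continuous (hline i) hB
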